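/- **Setting.** Let $A_{ij}$ ($1\le i,j\le N$) and $c$ be real coefficients in $C_b(\mathbb R^N;L^\infty(\mathbb T^N))$, where $\mathbb T^N=\mathbb R^N/\mathbb Z^N$; write $A=A(x,y)$, $c=c(x,y)$. Assume that $A$ is symmetric and uniformly coercive. For $x,\theta\in\mathbb R^N$ let $\lambda_1(x,\theta)\le\lambda_2(x,\theta)\le\dots$ be the eigenvalues, repeated with multiplicity, of the cell problem $$-(\mathrm{div}_y+2i\pi\theta)\big(A(x,y)(\nabla_y+2i\pi\theta)\psi\big)+c(x,y)\psi=\lambda\,\psi\quad\text{in }\mathbb T^N,\qquad \psi\in H^1(\mathbb T^N;\mathbb C).$$ Fix $n\ge1$ and $(x^n,\theta^n)\in\mathbb R^N\times\mathbb R^N$ such that * (H1) $\lambda_n(x^n,\theta^n)$ is a simple eigenvalue, and $(x^n,\theta^n)$ is a critical point of $\lambda_n$: $\nabla_x\lambda_n(x^n,\theta^n)=\nabla_\theta\lambda_n(x^n,\theta^n)=0$; * (H2) $x\mapsto A(x,\cdot)$ and $x\mapsto c(x,\cdot)$ are of class $C^2$, with values in $L^\infty(\mathbb T^N)$, in a neighbourhood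 of $x^n$. Let $\psi_n(x,\cdot,\theta)$ be eigenfunctions associated with $\lambda_n(x,\theta)$, with $\|\psi_n(x,\cdot,\theta)\|_{L^2(\mathbb T^N)}=1$, chosen for $(x,\theta)$ near $(x^n,\theta^n)$ so that $(x,\theta)\mapsto\psi_n(x,\cdot,\theta)\in H^1(\mathbb T^N)$ is of class $C^1$ near $(x^n,\theta^n)$. Define $$A^*=\tfrac1{8\pi^2}\nabla_\theta\nabla_\theta\lambda_n(x^n,\theta^n),\quad B^*=\tfrac1{2i\pi}\nabla_\theta\nabla_x\lambda_n(x^n,\theta^n),\quad D^*=\tfrac12\nabla_x\nabla_x\lambda_n(x^n,\theta^n),$$ where $B^*_{kh}=\frac1{2i\pi}\frac{\partial^2\lambda_n}{\partial\theta_k\partial x_h}(x^n,\theta^n)$, and, with $(e_k)$ the canonical basis of $\mathbb R^N$ and everything evaluated at $(x^n,\theta^n)$, $$c^*=\sum_{k=1}^N\int_{\mathbb T^N}\Big[A(\nabla_y+2i\pi\theta^n)\psi_n\cdot\frac{\partial\bar\psi_n}{\partial x_k}e_k-A(\nabla_y-2i\pi\theta^n)\frac{\partial\bar\psi_n}{\partial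 x_k}\cdot\psi_ne_k-\frac{\partial A}{\partial x_k}(\nabla_y-2i\pi\theta^n)\bar\psi_n\cdot\psi_ne_k\Big]dy .$$ **Proposition 3.4.** 1. Let $v^0\in L^2(\mathbb R^N;\mathbb C)$ and let $v\in C(\mathbb R^+;L^2(\mathbb R^N;\mathbb C))$ be a solution (in the sense of distributions on $(0,\infty)\times\mathbb R^N$, with $v(0,\cdot)=v^0$) of $$i\frac{\partial v}{\partial t}-\mathrm{div}(A^*\nabla v)+\mathrm{div}(v\,B^*z)+c^*v+v\,D^*z\cdot z=0 .$$ Then $\|v(t,\cdot)\|_{L^2(\mathbb R^N)}=\|v^0\|_{L^2(\mathbb R^N)}$ for all $t\ge0$. 2. The operator $\mathbb A^*\varphi=-\mathrm{div}(A^*\nabla\varphi)+\mathrm{div}(\varphi B^*z)+c^*\varphi+\varphi\,D^*z\cdot z$ in $L^2(\mathbb R^N;\mathbb C)$, with domain the set of all $\varphi\in L^2(\mathbb R^N;\mathbb C)$ such that $\mathbb A^*\varphi$, computed in the sense of distributions, belongs to $L^2(\mathbb R^N;\mathbb C)$, is self-adjoint. 3. The coefficients satisfy $\frac1{2i}\,\mathrm{tr}\,B^*+\mathrm{Im}\,c^*=0$.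 -/

import Mathlib

open MeasureTheory
open scoped ContDiff

noncomputable section

namespace BlochHom

/-! ### Function spaces -/

/-- The space `ℝ^N` with its Euclidean norm. -/
abbrev Space (N : ℕ) : Type := EuclideanSpace ℝ (Fin N)

/-- The unit torus `𝕋^N = (ℝ / ℤ)^N`. -/
abbrev Torus (N : ℕ) : Type := UnitAddTorus (Fin N)

/-- Lebesgue measure `dy` on the unit torus: the product of the Haar probability measures of the
factors `ℝ / ℤ`. -/
abbrev torusMeasure (N : ℕ) : Measure (Torus N) :=
  Measure.pi fun _ : Fin N => (AddCircle.haarAddCircle : Measure UnitAddCircle)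

/-- `L²(𝕋^N; ℂ)`. -/
abbrev L2Torus (N : ℕ) : Type := Lp ℂ 2 (torusMeasure N)

/-- `L^∞(𝕋^N; ℝ)`. -/
abbrev LinftyTorus (N : ℕ) : Type := Lp ℝ ⊤ (torusMeasure N)

/-- `L²(ℝ^N; ℂ)`. -/
abbrev L2Space (N : ℕ) : Type := Lp ℂ 2 (volume : Measure (Space N))

/-- The Fourier character `y ↦ exp (2 i π m · y)` as an element of `L²(𝕋^N)`. -/
def character {N : ℕ} (m : Fin N → ℤ) : L2Torus N :=
  ContinuousMap.toLp (E := ℂ) 2 (torusMeasure N) ℂ (UnitAddTorus.mFourier m)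

/-- The periodic Sobolev space `H¹(𝕋^N; ℂ)`, realized as the graph of the weak gradient: the pairs
`(u, g)` with `u ∈ L²`, `g = (g₁, …, g_N) ∈ (L²)^N` and `g_k = ∂u/∂y_k` weakly, the weak derivative
being tested on the Fourier characters. It carries the norm induced by `L² × (L²)^N`, which is
equivalent to the usual `H¹` norm. -/
def H1 (N : ℕ) : Submodule ℂ (L2Torus N × (Fin N → L2Torus N)) where
  carrier := {u | ∀ (k : Fin N) (m : Fin N → ℤ),
    inner ℂ (character m) (u.2 k) =
      2 * Real.pi * Complex.I * (m k : ℂ) * inner ℂ (character m) u.1}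
  add_mem' := by
    intro u v hu hv k m
    simp only [Prod.fst_add, Prod.snd_add, Pi.add_apply, inner_add_right, hu k m, hv k m]
    ring
  zero_mem' := by
    intro k m
    simp
  smul_mem' := by
    intro a u hu k m
    simp only [Prod.smul_fst, Prod.smul_snd, Pi.smul_apply, inner_smul_right, hu k m]
    ring

/-- The underlying `L²` function of an element of `H¹(𝕋^N)`. -/
def fn {N : ℕ} (u : H1 N) : L2Torus N := u.1.1

/-- The weak derivative `∂u/∂y_j` of an element of `H¹(𝕋^N)`. -/
def weakPartial {N : ℕ} (u : H1 N) (j : Fin N) : L2Torus N := u.1.2 j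

/-- `j`-th component of `(∇_y + 2 i π θ) u`. -/
def shiftedGrad {N : ℕ} (θ : Space N) (u : H1 N) (j : Fin N) (y : Torus N) : ℂ :=
  weakPartial u j y + 2 * Complex.I * Real.pi * (θ j : ℂ) * fn u y

/-! ### The Bloch cell problem -/

/-- The coefficients of class `C_b(ℝ^N; L^∞(𝕋^N))`, as matrix entries `A_{ij}(x, y)`. -/
abbrev MatrixCoeff (N : ℕ) : Type :=
  Fin N → Fin N → BoundedContinuousFunction (Space N) (LinftyTorus N)

/-- Scalar coefficients of class `C_b(ℝ^N; L^∞(𝕋^N))`. -/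
abbrev ScalarCoeff (N : ℕ) : Type := BoundedContinuousFunction (Space N) (LinftyTorus N)

variable {N : ℕ}

/-- The tensor `A(x, y)` is symmetric. -/
def IsSymmetricCoeff (A : MatrixCoeff N) : Prop := ∀ x i j, A i j x = A j i x

/-- The tensor `A(x, y)` is uniformly coercive. -/
def IsUniformlyCoercive (A : MatrixCoeff N) : Prop :=
  ∃ α : ℝ, 0 < α ∧ ∀ x, ∀ᵐ y ∂(torusMeasure N), ∀ ξ : Fin N → ℝ,
    α * ∑ i, ξ i ^ 2 ≤ ∑ i, ∑ j, A i j x y * ξ j * ξ i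

/-- The sesquilinear form of the cell operator
`- (div_y + 2 i π θ) (A(x, y) (∇_y + 2 i π θ) u) + c(x, y) u` on `H¹(𝕋^N)`:
`∫ A (∇_y + 2 i π θ) u · conj ((∇_y + 2 i π θ) w) + c u conj w dy`. -/
def cellForm (A : MatrixCoeff N) (c : ScalarCoeff N) (x θ : Space N) (u w : H1 N) : ℂ :=
  ∫ y, ((∑ i, ∑ j, (A i j x y : ℂ) * shiftedGrad θ u j y * star (shiftedGrad θ w i y))
    + (c x y : ℂ) * fn u y * star (fn w y)) ∂(torusMeasure N)

/-- `u ∈ H¹(𝕋^N)` solves the cell equation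
`- (div_y + 2 i π θ) (A(x, y) (∇_y + 2 i π θ) u) + c(x, y) u = s u` in `𝕋^N` (weakly). -/
def SolvesCell (A : MatrixCoeff N) (c : ScalarCoeff N) (x θ : Space N) (s : ℝ) (u : H1 N) : Prop :=
  ∀ w : H1 N, cellForm A c x θ u w = (s : ℂ) * inner ℂ (fn w) (fn u)

/-- The eigenspace of the cell operator for the value `s` (the solution set of the cell equation is
already a subspace). -/
def cellEigenspace (A : MatrixCoeff N) (c : ScalarCoeff N) (x θ : Space N) (s : ℝ) :
    Submodule ℂ (H1 N) :=
  Submodule.span ℂ {u | SolvesCell A c x θ s u}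

/-- The `n`-th Bloch eigenvalue `λ_n(x, θ)`, `n ≥ 1`: the eigenvalues of the cell operator are
listed in increasing order and repeated with their multiplicity, so `λ_n` is the least `s` such that
the eigenspaces for the eigenvalues `≤ s` have total dimension at least `n`. -/
def blochEigenvalue (A : MatrixCoeff N) (c : ScalarCoeff N) (n : ℕ) (x θ : Space N) : ℝ :=
  sInf {s : ℝ | (n : Cardinal) ≤ Module.rank ℂ ↥(⨆ t : Set.Iic s, cellEigenspace A c x θ t)}

/-- `λ_n` as a function of the pair `(x, θ)`. -/
def blochFun (A : MatrixCoeff N) (c : ScalarCoeff N) (n : ℕ) : Space N × Space N → ℝ :=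
  fun p => blochEigenvalue A c n p.1 p.2

/-- `ψ` is, near `(x₀, θ₀)`, a branch of class `C¹` (with values in `H¹(𝕋^N)`) of `n`-th Bloch
eigenfunctions normalized in `L²(𝕋^N)`. -/
def IsBlochBranch (A : MatrixCoeff N) (c : ScalarCoeff N) (n : ℕ) (x₀ θ₀ : Space N)
    (ψ : Space N × Space N → H1 N) : Prop :=
  ContDiffAt ℝ 1 ψ (x₀, θ₀) ∧
  ∀ᶠ p in nhds (x₀, θ₀),
    SolvesCell A c p.1 p.2 (blochEigenvalue A c n p.1 p.2) (ψ p) ∧ ‖fn (ψ p)‖ = 1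

/-! ### The homogenized coefficients -/

/-- The canonical basis of `ℝ^N`. -/
def e (i : Fin N) : Space N := EuclideanSpace.single i 1

/-- The direction of `∂/∂x_i` in `(x, θ)`-space. -/
def dx (i : Fin N) : Space N × Space N := (e i, 0)

/-- The direction of `∂/∂θ_i` in `(x, θ)`-space. -/
def dθ (i : Fin N) : Space N × Space N := (0, e i)

/-- The second derivative `∂_v ∂_w f (p)`. -/
def secondDeriv (f : Space N × Space N → ℝ) (p v w : Space N × Space N) : ℝ :=
  fderiv ℝ (fderiv ℝ f) p v w

/-- `A* = (1 / 8π²) ∇_θ ∇_θ λ_n (x₀, θ₀)`. -/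
def homA (A : MatrixCoeff N) (c : ScalarCoeff N) (n : ℕ) (x₀ θ₀ : Space N) :
    Matrix (Fin N) (Fin N) ℝ :=
  Matrix.of fun i j => 1 / (8 * Real.pi ^ 2) *
    secondDeriv (blochFun A c n) (x₀, θ₀) (dθ i) (dθ j)

/-- `B* = (1 / 2iπ) ∇_θ ∇_x λ_n (x₀, θ₀)`, with entries
`B*_{kh} = (1 / 2iπ) ∂²λ_n / ∂θ_k ∂x_h`. -/
def homB (A : MatrixCoeff N) (c : ScalarCoeff N) (n : ℕ) (x₀ θ₀ : Space N) :
    Matrix (Fin N) (Fin N) ℂ :=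
  Matrix.of fun k h => 1 / (2 * Complex.I * Real.pi) *
    (secondDeriv (blochFun A c n) (x₀, θ₀) (dθ k) (dx h) : ℂ)

/-- `D* = (1 / 2) ∇_x ∇_x λ_n (x₀, θ₀)`. -/
def homD (A : MatrixCoeff N) (c : ScalarCoeff N) (n : ℕ) (x₀ θ₀ : Space N) :
    Matrix (Fin N) (Fin N) ℝ :=
  Matrix.of fun l h => 1 / 2 * secondDeriv (blochFun A c n) (x₀, θ₀) (dx l) (dx h)

/-- The derivative `∂A_{ij}/∂x_k (x₀, ·) ∈ L^∞(𝕋^N)`. -/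
def coeffDeriv (A : MatrixCoeff N) (x₀ : Space N) (k i j : Fin N) : LinftyTorus N :=
  fderiv ℝ (fun x => A i j x) x₀ (e k)

/-- The derivative `∂ψ/∂x_k (x₀, ·, θ₀) ∈ H¹(𝕋^N)`. -/
def branchDeriv (ψ : Space N × Space N → H1 N) (x₀ θ₀ : Space N) (k : Fin N) : H1 N :=
  fderiv ℝ ψ (x₀, θ₀) (dx k)

/-- The constant (summation over `k`)
`c* = ∫ [A (∇_y + 2iπθ) ψ · conj (∂ψ/∂x_k) e_k - A (∇_y - 2iπθ) conj (∂ψ/∂x_k) · ψ e_k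
  - (∂A/∂x_k) (∇_y - 2iπθ) (conj ψ) · ψ e_k] dy`, everything being taken at `(x₀, θ₀)`. -/
def homC (A : MatrixCoeff N) (x₀ θ₀ : Space N) (ψ : Space N × Space N → H1 N) : ℂ :=
  ∫ y, ∑ k, ∑ j,
    ((A k j x₀ y : ℂ) * shiftedGrad θ₀ (ψ (x₀, θ₀)) j y * star (fn (branchDeriv ψ x₀ θ₀ k) y)
    - (A k j x₀ y : ℂ) * star (shiftedGrad θ₀ (branchDeriv ψ x₀ θ₀ k) j y)
        * fn (ψ (x₀, θ₀)) y
    - (coeffDeriv A x₀ k k j y : ℂ) * star (shiftedGrad θ₀ (ψ (x₀, θ₀)) j y)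
        * fn (ψ (x₀, θ₀)) y) ∂(torusMeasure N)

/-! ### The homogenized operator and the homogenized equation

In this part `a`, `b`, `c`, `d` are arbitrary constant coefficients. -/

/-- The partial derivative `∂η/∂z_i`. -/
def partialDeriv (i : Fin N) (η : Space N → ℂ) (z : Space N) : ℂ := fderiv ℝ η z (e i)

/-- The (real, bilinear) transpose
`η ↦ - ∑ a_{ij} ∂_i ∂_j η - (b z) · ∇η + c η + (d z · z) η`
of the differential expression `φ ↦ - div (a ∇φ) + div (φ b z) + c φ + φ (d z · z)`, acting on
smooth functions `η`. -/
def transposeOp (a : Matrix (Fin N) (Fin N) ℝ) (b : Matrix (Fin N) (Fin N) ℂ) (c : ℂ)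
    (d : Matrix (Fin N) (Fin N) ℝ) (η : Space N → ℂ) (z : Space N) : ℂ :=
  -(∑ i, ∑ j, (a i j : ℂ) * partialDeriv i (partialDeriv j η) z)
    - (∑ i, (∑ j, b i j * (z j : ℂ)) * partialDeriv i η z)
    + c * η z
    + (∑ i, ∑ j, (d i j : ℂ) * (z j : ℂ) * (z i : ℂ)) * η z

/-- Complex test functions on `ℝ^N`. -/
def IsTest (η : Space N → ℂ) : Prop := ContDiff ℝ ∞ η ∧ HasCompactSupport η

/-- `- div (a ∇φ) + div (φ b z) + c φ + φ (d z · z) = f` in the sense of distributions on `ℝ^N`. -/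
def DistribEq (a : Matrix (Fin N) (Fin N) ℝ) (b : Matrix (Fin N) (Fin N) ℂ) (c : ℂ)
    (d : Matrix (Fin N) (Fin N) ℝ) (φ f : L2Space N) : Prop :=
  ∀ η : Space N → ℂ, IsTest η → ∫ z, φ z * transposeOp a b c d η z = ∫ z, f z * η z

lemma contDiff_partialDeriv {η : Space N → ℂ} (hη : ContDiff ℝ ∞ η) (i : Fin N) :
    ContDiff ℝ ∞ (partialDeriv i η) := by
  unfold partialDeriv
  exact (hη.fderiv_right (m := ∞) (by simp)).clm_apply contDiff_const

lemma IsTest.partialDeriv {η : Space N → ℂ} (hη : IsTest η) (i : Fin N) :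
    IsTest (partialDeriv i η) :=
  ⟨contDiff_partialDeriv hη.1 i, hη.2.fderiv_apply (𝕜 := ℝ) (e i)⟩

lemma IsTest.continuous_transposeOp {η : Space N → ℂ} (hη : IsTest η)
    (a : Matrix (Fin N) (Fin N) ℝ) (b : Matrix (Fin N) (Fin N) ℂ) (c : ℂ)
    (d : Matrix (Fin N) (Fin N) ℝ) : Continuous (transposeOp a b c d η) := by
  have h0 := hη.1.continuous
  have h1 := fun i => (hη.partialDeriv i).1.continuous
  have h2 := fun i j => ((hη.partialDeriv j).partialDeriv i).1.continuous
  unfold transposeOp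
  fun_prop

lemma IsTest.hasCompactSupport_transposeOp {η : Space N → ℂ} (hη : IsTest η)
    (a : Matrix (Fin N) (Fin N) ℝ) (b : Matrix (Fin N) (Fin N) ℂ) (c : ℂ)
    (d : Matrix (Fin N) (Fin N) ℝ) : HasCompactSupport (transposeOp a b c d η) := by
  refine HasCompactSupport.intro hη.2 fun z hz => ?_
  have key : ∀ (f : Space N → ℂ) (i : Fin N), tsupport (BlochHom.partialDeriv i f) ⊆ tsupport f :=
    fun f i => (tsupport_fderiv_apply_subset ℝ (f := f) (e i))
  have h0 : η z = 0 := image_eq_zero_of_notMem_tsupport hz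
  have h1 : ∀ i, BlochHom.partialDeriv i η z = 0 := fun i =>
    image_eq_zero_of_notMem_tsupport fun h => hz (key η i h)
  have h2 : ∀ i j, BlochHom.partialDeriv i (BlochHom.partialDeriv j η) z = 0 := fun i j =>
    image_eq_zero_of_notMem_tsupport fun h => hz (key η j (key _ i h))
  simp [transposeOp, h0, h1, h2]

lemma integrable_mul_of_compact (φ : L2Space N) {g : Space N → ℂ} (hg : Continuous g)
    (hs : HasCompactSupport g) : Integrable (fun z => φ z * g z) :=
  (Lp.memLp φ).integrable_mul (hg.memLp_of_hasCompactSupport (p := 2) hs)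

/-- The graph of the homogenized operator with its maximal domain. -/
def homGraph (a : Matrix (Fin N) (Fin N) ℝ) (b : Matrix (Fin N) (Fin N) ℂ) (c : ℂ)
    (d : Matrix (Fin N) (Fin N) ℝ) : Submodule ℂ (L2Space N × L2Space N) where
  carrier := {q | DistribEq a b c d q.1 q.2}
  add_mem' := by
    intro p q hp hq η hη
    have hT := hη.continuous_transposeOp a b c d
    have hS := hη.hasCompactSupport_transposeOp a b c d
    have e1 : ∫ z, (p + q).1 z * transposeOp a b c d η z =
        ∫ z, (p.1 z * transposeOp a b c d η z + q.1 z * transposeOp a b c d η z) := by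
      refine integral_congr_ae ?_
      filter_upwards [Lp.coeFn_add p.1 q.1] with z hz
      rw [Prod.fst_add, hz, Pi.add_apply, add_mul]
    have e2 : ∫ z, (p + q).2 z * η z = ∫ z, (p.2 z * η z + q.2 z * η z) := by
      refine integral_congr_ae ?_
      filter_upwards [Lp.coeFn_add p.2 q.2] with z hz
      rw [Prod.snd_add, hz, Pi.add_apply, add_mul]
    rw [e1, e2, integral_add (integrable_mul_of_compact _ hT hS) (integrable_mul_of_compact _ hT hS),
      integral_add (integrable_mul_of_compact _ hη.1.continuous hη.2)
        (integrable_mul_of_compact _ hη.1.continuous hη.2), hp η hη, hq η hη]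
  zero_mem' := by
    intro η hη
    have e1 : ∫ z, (0 : L2Space N) z * transposeOp a b c d η z = ∫ _ : Space N, (0 : ℂ) := by
      refine integral_congr_ae ?_
      filter_upwards [Lp.coeFn_zero ℂ 2 (volume : Measure (Space N))] with z hz
      rw [hz, Pi.zero_apply, zero_mul]
    have e2 : ∫ z, (0 : L2Space N) z * η z = ∫ _ : Space N, (0 : ℂ) := by
      refine integral_congr_ae ?_
      filter_upwards [Lp.coeFn_zero ℂ 2 (volume : Measure (Space N))] with z hz
      rw [hz, Pi.zero_apply, zero_mul]
    exact e1.trans e2.symm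
  smul_mem' := by
    intro r p hp η hη
    have e1 : ∫ z, (r • p).1 z * transposeOp a b c d η z =
        ∫ z, r * (p.1 z * transposeOp a b c d η z) := by
      refine integral_congr_ae ?_
      filter_upwards [Lp.coeFn_smul r p.1] with z hz
      simp [hz, mul_assoc]
    have e2 : ∫ z, (r • p).2 z * η z = ∫ z, r * (p.2 z * η z) := by
      refine integral_congr_ae ?_
      filter_upwards [Lp.coeFn_smul r p.2] with z hz
      simp [hz, mul_assoc]
    rw [e1, e2, integral_const_mul, integral_const_mul, hp η hη]

/-- The graph is single-valued. -/
lemma homGraph_single_valued (a : Matrix (Fin N) (Fin N) ℝ) (b : Matrix (Fin N) (Fin N) ℂ) (c : ℂ)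
    (d : Matrix (Fin N) (Fin N) ℝ) :
    ∀ q ∈ homGraph a b c d, q.1 = 0 → q.2 = 0 := by
  rintro ⟨φ, f⟩ hq h0
  obtain rfl : φ = 0 := h0
  have hf : LocallyIntegrable (f : Space N → ℂ) volume :=
    (Lp.memLp f).locallyIntegrable (by norm_num)
  have hae : ∀ᵐ z : Space N, f z = 0 := by
    refine ae_eq_zero_of_integral_contDiff_smul_eq_zero hf fun g hg hgs => ?_
    have ht : IsTest (fun z => (g z : ℂ)) :=
      ⟨Complex.ofRealCLM.contDiff.comp hg, hgs.comp_left (g := Complex.ofReal) (by simp)⟩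
    have h1 := hq _ ht
    have e1 : ∫ z, (0 : L2Space N) z * transposeOp a b c d (fun z => (g z : ℂ)) z = 0 := by
      refine (integral_congr_ae ?_).trans (integral_zero (Space N) ℂ)
      filter_upwards [Lp.coeFn_zero ℂ 2 (volume : Measure (Space N))] with z hz
      rw [hz, Pi.zero_apply, zero_mul]
    have h2 : ∫ z, f z * (g z : ℂ) = 0 := h1.symm.trans e1
    rw [← h2]
    refine integral_congr_ae (Filter.Eventually.of_forall fun z => ?_)
    simp [Complex.real_smul, mul_comm]
  refine Lp.ext ?_
  filter_upwards [hae, Lp.coeFn_zero ℂ 2 (volume : Measure (Space N))] with z hz h0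
  rw [hz, h0, Pi.zero_apply]

/-- The unbounded operator `φ ↦ - div (a ∇φ) + div (φ b z) + c φ + φ (d z · z)` of `L²(ℝ^N)` with
its maximal domain, the set of all `φ ∈ L²(ℝ^N)` whose image in the sense of distributions lies in
`L²(ℝ^N)`. -/
def homOperator (a : Matrix (Fin N) (Fin N) ℝ) (b : Matrix (Fin N) (Fin N) ℂ) (c : ℂ)
    (d : Matrix (Fin N) (Fin N) ℝ) : L2Space N →ₗ.[ℂ] L2Space N :=
  (homGraph a b c d).toLinearPMap

lemma mem_graph_homOperator (a : Matrix (Fin N) (Fin N) ℝ) (b : Matrix (Fin N) (Fin N) ℂ) (c : ℂ)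
    (d : Matrix (Fin N) (Fin N) ℝ) (φ f : L2Space N) :
    (φ, f) ∈ (homOperator a b c d).graph ↔ DistribEq a b c d φ f := by
  unfold homOperator
  rw [Submodule.toLinearPMap_graph_eq _ (homGraph_single_valued a b c d)]
  rfl

/-- `v ∈ C(ℝ⁺; L²(ℝ^N))` is a solution of
`i ∂v/∂t - div (a ∇v) + div (v b z) + c v + v (d z · z) = 0` in `ℝ^N × (0, ∞)` (in the sense of
distributions) with `v(0) = v⁰`. -/
def SolvesHom (a : Matrix (Fin N) (Fin N) ℝ) (b : Matrix (Fin N) (Fin N) ℂ) (c : ℂ)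
    (d : Matrix (Fin N) (Fin N) ℝ) (v₀ : L2Space N) (v : ℝ → L2Space N) : Prop :=
  ContinuousOn v (Set.Ici 0) ∧ v 0 = v₀ ∧
  ∀ η : ℝ × Space N → ℂ, ContDiff ℝ ∞ η → HasCompactSupport η →
    tsupport η ⊆ Set.Ioi (0 : ℝ) ×ˢ Set.univ →
    ∫ t in Set.Ioi (0 : ℝ), ∫ z, v t z *
      (-(Complex.I * deriv (fun s => η (s, z)) t)
        + transposeOp a b c d (fun z' => η (t, z')) z) = 0

end BlochHom

end

noncomputable section

namespace BlochHom

variable {N : ℕ}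

/-! ### Calculus of partial derivatives -/

/-! All three claims rest on three properties of the constants: `A*` is real symmetric, `B*` has
purely imaginary entries, and `star c* = c* + tr B*`. Integration by parts shows that the last one
is what makes the operator formally symmetric, since the divergence of `z ↦ B* z` is `tr B*`. It is
equivalent to `tr B* = -2i Im c*`, which is the third claim.

That identity is a Hellmann–Feynman computation. Near the critical point `λ_n` is the value of the
cell quadratic form `q` at the normalized eigenfunction `ψ_n`. The variation of `ψ_n` contributes
nothing to the first derivative, so the gradient of `λ_n` is the partial gradient of `q` in `(x,
θ)`. Hence `λ_n` is of class C² although `ψ_n` is only C¹ (`contDiffAt_two_of_critical`), and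
`∂λ_n/∂θ_k` is `4π` times the imaginary part of a flux. Differentiating in `x_k` and summing over
`k` produces `4π Im c*` (`IsBlochBranch.secondDeriv_eq`, `homC_im`).

For self-adjointness, formal symmetry is not enough: the coefficients grow at infinity, `A*` has no
sign, and the domain is maximal. An element `ψ` of the domain is approximated by `χ(ε z) (ρ_ε ∗ ψ)`,
with the same `ε` for cut-off and mollifier. The commutator with the operator has a kernel dominated
by a fixed multiple of `ε^{-N}` on `|z - y| ≤ ε` (`exists_commKernel_bound`), so by Young's
inequality the images stay bounded in L². Boundedness and distributional convergence give weak
convergence, and symmetry passes to the whole maximal domain (`DistribEq.inner_eq`). Conversely,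
pairing with test functions shows that the adjoint is contained in the maximal operator.

For conservation of the norm, `v(t)` need not lie in the domain, but `V(t) = ∫_t^{t+δ} v` does, with
image `-i V'(t)`. Symmetry makes `‖V‖` constant; dividing by `δ` and letting `δ → 0` gives the
claim. -/

lemma partialDeriv_mul {f g : Space N → ℂ} (hf : ContDiff ℝ ∞ f) (hg : ContDiff ℝ ∞ g)
    (i : Fin N) :
    partialDeriv i (fun z => f z * g z) =
      fun z => partialDeriv i f z * g z + f z * partialDeriv i g z := by
  funext z
  have h := ((hf.differentiable (by simp) z).hasFDerivAt.mul
    (hg.differentiable (by simp) z).hasFDerivAt).fderiv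
  unfold partialDeriv
  rw [show (fun z => f z * g z) = f * g from rfl, h]
  simp
  ring

lemma partialDeriv_add {f g : Space N → ℂ} (hf : ContDiff ℝ ∞ f) (hg : ContDiff ℝ ∞ g)
    (i : Fin N) :
    partialDeriv i (fun z => f z + g z) = fun z => partialDeriv i f z + partialDeriv i g z := by
  funext z
  have h := ((hf.differentiable (by simp) z).hasFDerivAt.add
    (hg.differentiable (by simp) z).hasFDerivAt).fderiv
  unfold partialDeriv
  rw [show (fun z => f z + g z) = f + g from rfl, h]
  simp

lemma partialDeriv_const_mul {f : Space N → ℂ} (hf : ContDiff ℝ ∞ f) (r : ℂ) (i : Fin N) :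
    partialDeriv i (fun z => r * f z) = fun z => r * partialDeriv i f z := by
  funext z
  have h := ((hf.differentiable (by simp) z).hasFDerivAt.const_mul r).fderiv
  unfold partialDeriv
  rw [h]
  simp

lemma partialDeriv_star (f : Space N → ℂ) (i : Fin N) :
    partialDeriv i (fun z => star (f z)) = fun z => star (partialDeriv i f z) := by
  funext z
  have h := Complex.conjCLE.comp_fderiv (f := f) (x := z)
  unfold partialDeriv
  exact DFunLike.congr_fun h (e i)

lemma partialDeriv_comp_smul {f : Space N → ℂ} (hf : ContDiff ℝ ∞ f) (s : ℝ) (i : Fin N) :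
    partialDeriv i (fun z => f (s • z)) = fun z => (s : ℂ) * partialDeriv i f (s • z) := by
  funext z
  have h := ((hf.differentiable (by simp) (s • z)).hasFDerivAt.comp z
    ((hasFDerivAt_id z).const_smul s)).fderiv
  exact (DFunLike.congr_fun h (e i)).trans (by simp [partialDeriv])

lemma partialDeriv_comp_sub {f : Space N → ℂ} (hf : ContDiff ℝ ∞ f) (z : Space N) (i : Fin N) :
    partialDeriv i (fun y => f (z - y)) = fun y => -partialDeriv i f (z - y) := by
  funext y
  have h := ((hf.differentiable (by simp) (z - y)).hasFDerivAt.comp y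
    ((hasFDerivAt_id y).const_sub z)).fderiv
  exact (DFunLike.congr_fun h (e i)).trans (by simp [partialDeriv])

/-- The linear form `z ↦ (b z)_i`. -/
def linForm (b : Matrix (Fin N) (Fin N) ℂ) (i : Fin N) (z : Space N) : ℂ := ∑ j, b i j * (z j : ℂ)

lemma hasFDerivAt_coord (j : Fin N) (z : Space N) :
    HasFDerivAt (fun z : Space N => (z j : ℂ))
      (Complex.ofRealCLM.comp (EuclideanSpace.proj j : Space N →L[ℝ] ℝ)) z :=
  (Complex.ofRealCLM.comp (EuclideanSpace.proj j : Space N →L[ℝ] ℝ)).hasFDerivAt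

lemma contDiff_coord (j : Fin N) : ContDiff ℝ ∞ (fun z : Space N => (z j : ℂ)) :=
  (Complex.ofRealCLM.comp (EuclideanSpace.proj j : Space N →L[ℝ] ℝ)).contDiff

lemma contDiff_linForm (b : Matrix (Fin N) (Fin N) ℂ) (i : Fin N) : ContDiff ℝ ∞ (linForm b i) :=
  ContDiff.sum fun j _ => contDiff_const.mul (contDiff_coord j)

lemma partialDeriv_linForm (b : Matrix (Fin N) (Fin N) ℂ) (i k : Fin N) :
    partialDeriv k (linForm b i) = fun _ => b i k := by
  funext z
  have h : HasFDerivAt (linForm b i) (∑ j, b i j •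
      (Complex.ofRealCLM.comp (EuclideanSpace.proj j : Space N →L[ℝ] ℝ))) z :=
    HasFDerivAt.fun_sum fun j _ => (hasFDerivAt_coord j z).const_mul (b i j)
  unfold partialDeriv
  rw [h.fderiv]
  simp [e, apply_ite Complex.ofReal]

/-- The quadratic form `z ↦ d z · z`. -/
def quadForm (d : Matrix (Fin N) (Fin N) ℝ) (z : Space N) : ℂ :=
  ∑ i, ∑ j, (d i j : ℂ) * (z j : ℂ) * (z i : ℂ)

lemma contDiff_quadForm (d : Matrix (Fin N) (Fin N) ℝ) : ContDiff ℝ ∞ (quadForm d) :=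
  ContDiff.sum fun i _ => ContDiff.sum fun j _ =>
    (contDiff_const.mul (contDiff_coord j)).mul (contDiff_coord i)

lemma transposeOp_eq (a : Matrix (Fin N) (Fin N) ℝ) (b : Matrix (Fin N) (Fin N) ℂ) (c : ℂ)
    (d : Matrix (Fin N) (Fin N) ℝ) (η : Space N → ℂ) (z : Space N) :
    transposeOp a b c d η z =
      -(∑ i, ∑ j, (a i j : ℂ) * partialDeriv i (partialDeriv j η) z)
        - (∑ i, linForm b i z * partialDeriv i η z) + c * η z + quadForm d z * η z := rfl

lemma linForm_neg (b : Matrix (Fin N) (Fin N) ℂ) (i : Fin N) (z : Space N) :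
    linForm (-b) i z = -linForm b i z := by
  simp [linForm]

/-! ### Test functions -/

lemma IsTest.mul_left {f η : Space N → ℂ} (hη : IsTest η) (hf : ContDiff ℝ ∞ f) :
    IsTest (fun z => f z * η z) :=
  ⟨hf.mul hη.1, hη.2.mul_left⟩

lemma IsTest.star {η : Space N → ℂ} (hη : IsTest η) : IsTest (fun z => star (η z)) :=
  ⟨Complex.conjCLE.contDiff.comp hη.1, hη.2.comp_left (g := fun w : ℂ => Star.star w) (by simp)⟩

lemma IsTest.comp_smul {η : Space N → ℂ} (hη : IsTest η) {s : ℝ} (hs : s ≠ 0) :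
    IsTest (fun z => η (s • z)) :=
  ⟨hη.1.comp (contDiff_const_smul s), hη.2.comp_smul hs⟩

lemma IsTest.comp_sub {η : Space N → ℂ} (hη : IsTest η) (z : Space N) :
    IsTest (fun y => η (z - y)) :=
  ⟨hη.1.comp (contDiff_const.sub contDiff_id),
    hη.2.comp_homeomorph (Homeomorph.subLeft z)⟩

lemma IsTest.integrable_mul {f η : Space N → ℂ} (hη : IsTest η) (hf : Continuous f) :
    Integrable (fun z => f z * η z) :=
  (hf.mul hη.1.continuous).integrable_of_hasCompactSupport hη.2.mul_left

lemma IsTest.memLp {η : Space N → ℂ} (hη : IsTest η) : MemLp η 2 (volume : Measure (Space N)) :=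
  hη.1.continuous.memLp_of_hasCompactSupport hη.2

lemma IsTest.contDiff_transposeOp {η : Space N → ℂ} (hη : IsTest η)
    (a : Matrix (Fin N) (Fin N) ℝ) (b : Matrix (Fin N) (Fin N) ℂ) (c : ℂ)
    (d : Matrix (Fin N) (Fin N) ℝ) : ContDiff ℝ ∞ (transposeOp a b c d η) := by
  have h1 := fun i => (hη.partialDeriv i).1
  have h2 := fun i j => ((hη.partialDeriv j).partialDeriv i).1
  have e : transposeOp a b c d η = fun z =>
      -(∑ i, ∑ j, (a i j : ℂ) * BlochHom.partialDeriv i (BlochHom.partialDeriv j η) z)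
        - (∑ i, linForm b i z * BlochHom.partialDeriv i η z) + c * η z + quadForm d z * η z := rfl
  rw [e]
  refine ((ContDiff.sub (ContDiff.neg ?_) ?_).add (contDiff_const.mul hη.1)).add
    ((contDiff_quadForm d).mul hη.1)
  · exact ContDiff.sum fun i _ => ContDiff.sum fun j _ => contDiff_const.mul (h2 i j)
  · exact ContDiff.sum fun i _ => (contDiff_linForm b i).mul (h1 i)

lemma IsTest.transposeOp {η : Space N → ℂ} (hη : IsTest η)
    (a : Matrix (Fin N) (Fin N) ℝ) (b : Matrix (Fin N) (Fin N) ℂ) (c : ℂ)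
    (d : Matrix (Fin N) (Fin N) ℝ) : IsTest (transposeOp a b c d η) :=
  ⟨hη.contDiff_transposeOp a b c d, hη.hasCompactSupport_transposeOp a b c d⟩

/-! ### Integration by parts and the formal adjoint. -/

lemma integral_mul_partialDeriv {f η : Space N → ℂ} (hf : ContDiff ℝ ∞ f) (hη : IsTest η)
    (i : Fin N) :
    ∫ z, f z * partialDeriv i η z = -∫ z, partialDeriv i f z * η z := by
  refine integral_mul_fderiv_eq_neg_fderiv_mul_of_integrable ?_ ?_ ?_
    (fun z _ => hf.differentiable (by simp) z) (fun z _ => hη.1.differentiable (by simp) z)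
  · exact hη.integrable_mul (contDiff_partialDeriv hf i).continuous
  · exact (hη.partialDeriv i).integrable_mul hf.continuous
  · exact hη.integrable_mul hf.continuous

/-- The formal transpose of `transposeOp a b c d` is `transposeOp a (-b) (c + tr b) d`. -/
lemma integral_mul_transposeOp {a : Matrix (Fin N) (Fin N) ℝ} (ha : a.IsSymm)
    (b : Matrix (Fin N) (Fin N) ℂ) (c : ℂ) (d : Matrix (Fin N) (Fin N) ℝ)
    {ζ η : Space N → ℂ} (hζ : IsTest ζ) (hη : IsTest η) :
    ∫ z, ζ z * transposeOp a b c d η z =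
      ∫ z, transposeOp a (-b) (c + b.trace) d ζ z * η z := by
  have e1 : ∀ z, ζ z * transposeOp a b c d η z =
      -(∑ i, ∑ j, (a i j : ℂ) * (ζ z * partialDeriv i (partialDeriv j η) z))
        - (∑ i, (linForm b i z * ζ z) * partialDeriv i η z) + (c + quadForm d z) * ζ z * η z := by
    intro z
    rw [transposeOp_eq]
    simp only [mul_add, mul_sub, mul_neg, Finset.mul_sum, add_mul]
    have : ∀ i j, ζ z * ((a i j : ℂ) * partialDeriv i (partialDeriv j η) z) =
      (a i j : ℂ) * (ζ z * partialDeriv i (partialDeriv j η) z) := fun i j => by ring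
    have h2 : ∀ i, ζ z * (linForm b i z * partialDeriv i η z) =
      (linForm b i z * ζ z) * partialDeriv i η z := fun i => by ring
    simp only [this, h2]
    ring
  have e2 : ∀ z, transposeOp a (-b) (c + b.trace) d ζ z * η z =
      -(∑ i, ∑ j, (a i j : ℂ) * (partialDeriv i (partialDeriv j ζ) z * η z))
        + (∑ i, (partialDeriv i (fun z => linForm b i z * ζ z) z) * η z)
        + (c + quadForm d z) * ζ z * η z := by
    intro z
    rw [transposeOp_eq]
    have h : ∀ i, partialDeriv i (fun z => linForm b i z * ζ z) z =
        b i i * ζ z + linForm b i z * partialDeriv i ζ z := fun i => by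
      rw [partialDeriv_mul (contDiff_linForm b i) hζ.1, partialDeriv_linForm]
    simp only [h, linForm_neg, Matrix.trace, Matrix.diag, add_mul, Finset.sum_add_distrib,
      Finset.sum_mul, neg_mul, sub_mul, Finset.sum_neg_distrib, ← mul_assoc]
    ring
  have i1 : ∀ i j, Integrable (fun z => (a i j : ℂ) * (ζ z * partialDeriv i (partialDeriv j η) z)) :=
    fun i j => (((hη.partialDeriv j).partialDeriv i).integrable_mul hζ.1.continuous).const_mul _
  have i1' : ∀ i j, Integrable (fun z => (a i j : ℂ) * (partialDeriv i (partialDeriv j ζ) z * η z)) :=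
    fun i j => (hη.integrable_mul ((hζ.partialDeriv j).partialDeriv i).1.continuous).const_mul _
  have i2 : ∀ i, Integrable (fun z => (linForm b i z * ζ z) * partialDeriv i η z) := fun i =>
    (hη.partialDeriv i).integrable_mul ((contDiff_linForm b i).continuous.mul hζ.1.continuous)
  have i2' : ∀ i, Integrable (fun z => (partialDeriv i (fun z => linForm b i z * ζ z) z) * η z) :=
    fun i => hη.integrable_mul ((hζ.mul_left (contDiff_linForm b i)).partialDeriv i).1.continuous
  have i3 : Integrable (fun z => (c + quadForm d z) * ζ z * η z) :=
    hη.integrable_mul (((contDiff_quadForm d).continuous.const_add c).mul hζ.1.continuous)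
  have s1 := integrable_finsetSum Finset.univ fun i _ =>
    integrable_finsetSum Finset.univ fun j _ => i1 i j
  have s1' := integrable_finsetSum Finset.univ fun i _ =>
    integrable_finsetSum Finset.univ fun j _ => i1' i j
  have s2 := integrable_finsetSum Finset.univ fun i _ => i2 i
  have s2' := integrable_finsetSum Finset.univ fun i _ => i2' i
  have n1 : Integrable fun z =>
      -∑ i, ∑ j, (a i j : ℂ) * (ζ z * partialDeriv i (partialDeriv j η) z) := s1.neg
  have n1' : Integrable fun z =>
      -∑ i, ∑ j, (a i j : ℂ) * (partialDeriv i (partialDeriv j ζ) z * η z) := s1'.neg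
  have m1 : Integrable fun z => -∑ i, ∑ j, (a i j : ℂ) * (partialDeriv i (partialDeriv j ζ) z * η z)
      + ∑ i, partialDeriv i (fun z => linForm b i z * ζ z) z * η z := n1'.add s2'
  rw [integral_congr_ae (Filter.Eventually.of_forall e1),
    integral_congr_ae (Filter.Eventually.of_forall e2), integral_add (n1.sub' s2) i3,
    integral_add m1 i3, integral_sub n1 s2, integral_add n1' s2', integral_neg,
    integral_neg,
    integral_finsetSum _ fun i _ => i2 i, integral_finsetSum _ fun i _ => i2' i,
    integral_finsetSum _ fun i _ => integrable_finsetSum Finset.univ fun j _ => i1 i j,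
    integral_finsetSum _ fun i _ => integrable_finsetSum Finset.univ fun j _ => i1' i j]
  simp only [integral_finsetSum _ fun j _ => i1 _ j, integral_finsetSum _ fun j _ => i1' _ j,
    integral_const_mul]
  congr 1
  have k1 : ∀ i, ∫ z, linForm b i z * ζ z * partialDeriv i η z =
      -∫ z, partialDeriv i (fun z => linForm b i z * ζ z) z * η z := fun i =>
    integral_mul_partialDeriv ((contDiff_linForm b i).mul hζ.1) hη i
  -- Two integrations by parts reverse the order of the derivatives. The indices are then matched by
  -- the symmetry of `a`, without exchanging derivatives.
  have k2 : ∀ i j, ∫ z, ζ z * partialDeriv i (partialDeriv j η) z =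
      ∫ z, partialDeriv j (partialDeriv i ζ) z * η z := fun i j => by
    rw [integral_mul_partialDeriv hζ.1 (hη.partialDeriv j),
      integral_mul_partialDeriv (contDiff_partialDeriv hζ.1 i) hη, neg_neg]
  simp only [k1, k2, Finset.sum_neg_distrib, sub_neg_eq_add]
  congr 2
  rw [Finset.sum_comm]
  refine Finset.sum_congr rfl fun i _ => Finset.sum_congr rfl fun j _ => ?_
  rw [ha.apply]

/-- The entries of `a` and `d` are real and those of `b` imaginary, so conjugation only affects the
signs of `b` and the constant `c`. It converts bilinear identities into identities for the Hermitian
product. -/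
lemma star_transposeOp (a : Matrix (Fin N) (Fin N) ℝ) {b : Matrix (Fin N) (Fin N) ℂ}
    (hb : ∀ i j, star (b i j) = -b i j) (c : ℂ) (d : Matrix (Fin N) (Fin N) ℝ)
    (η : Space N → ℂ) (z : Space N) :
    star (transposeOp a b c d η z) = transposeOp a (-b) (star c) d (fun z => star (η z)) z := by
  simp only [transposeOp_eq, partialDeriv_star, linForm, quadForm, Matrix.neg_apply, ← hb]
  simp

/-! ### Young's inequality -/

/-- Writing `k = k^{1/2} k^{1/2}`, Cauchy–Schwarz bounds the squared convolution by the mass of `k`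
times `k ∗ f²`; Tonelli and translation invariance conclude. -/
lemma lintegral_sq_convolution_le {k f : Space N → ENNReal} (hk : Measurable k)
    (hf : AEMeasurable f) :
    ∫⁻ z, (∫⁻ y, k (z - y) * f y) ^ 2 ≤ (∫⁻ z, k z) ^ 2 * ∫⁻ z, f z ^ 2 := by
  have cs : ∀ z, (∫⁻ y, k (z - y) * f y) ^ 2 ≤
      (∫⁻ y, k y) * ∫⁻ y, k (z - y) * f y ^ 2 := by
    intro z
    have hkz : Measurable fun y => k (z - y) := hk.comp (measurable_const.sub measurable_id)
    have h := ENNReal.lintegral_mul_le_Lp_mul_Lq volume Real.HolderConjugate.two_two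
      (f := fun y => k (z - y) ^ (1 / 2 : ℝ)) (g := fun y => k (z - y) ^ (1 / 2 : ℝ) * f y)
      (hkz.pow_const _).aemeasurable ((hkz.pow_const _).aemeasurable.mul hf)
    have h1 : ∀ y, k (z - y) ^ (1 / 2 : ℝ) * k (z - y) ^ (1 / 2 : ℝ) = k (z - y) := fun y => by
      rw [← ENNReal.rpow_add_of_nonneg _ _ (by norm_num) (by norm_num)]
      norm_num
    have h2 : ∀ y, (k (z - y) ^ (1 / 2 : ℝ)) ^ (2 : ℝ) = k (z - y) := fun y => by
      rw [← ENNReal.rpow_mul]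
      norm_num
    simp only [Pi.mul_apply, ← mul_assoc, h1, h2, ENNReal.mul_rpow_of_nonneg _ _ zero_le_two] at h
    have h3 : (∫⁻ y, k (z - y)) = ∫⁻ y, k y := lintegral_sub_left_eq_self k z
    rw [h3] at h
    calc (∫⁻ y, k (z - y) * f y) ^ 2 ≤ _ := pow_le_pow_left' h 2
      _ = _ := by
        rw [mul_pow, ← ENNReal.rpow_natCast, ← ENNReal.rpow_natCast, ← ENNReal.rpow_mul,
          ← ENNReal.rpow_mul]
        norm_num
  have meas : AEMeasurable (Function.uncurry fun z y => k (z - y) * f y ^ 2)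
      (volume.prod volume) :=
    (hk.comp (measurable_fst.sub measurable_snd)).aemeasurable.mul
      ((hf.pow_const 2).comp_snd)
  calc ∫⁻ z, (∫⁻ y, k (z - y) * f y) ^ 2
      ≤ ∫⁻ z, (∫⁻ y, k y) * ∫⁻ y, k (z - y) * f y ^ 2 := lintegral_mono cs
    _ = (∫⁻ y, k y) * ∫⁻ z, ∫⁻ y, k (z - y) * f y ^ 2 :=
        lintegral_const_mul'' _ meas.lintegral_prod_right'
    _ = (∫⁻ y, k y) * ∫⁻ y, ∫⁻ z, k (z - y) * f y ^ 2 := by rw [lintegral_lintegral_swap meas]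
    _ = (∫⁻ y, k y) * ∫⁻ y, (∫⁻ z, k z) * f y ^ 2 := by
        congr 1
        refine lintegral_congr fun y => ?_
        have hky : Measurable fun z => k (z - y) := hk.comp (measurable_id.sub measurable_const)
        rw [lintegral_mul_const _ hky]
        congr 1
        exact lintegral_sub_right_eq_self k y
    _ = _ := by rw [lintegral_const_mul'' _ (hf.pow_const 2)]; ring

lemma lintegral_enorm_sq (φ : L2Space N) : ∫⁻ z, ‖φ z‖ₑ ^ 2 = ENNReal.ofReal ‖φ‖ ^ 2 := by
  have h := eLpNorm_eq_lintegral_rpow_enorm_toReal (p := 2) (μ := (volume : Measure (Space N)))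
    two_ne_zero ENNReal.ofNat_ne_top (f := φ)
  rw [ofReal_norm, Lp.enorm_def, h, ← ENNReal.rpow_natCast, ← ENNReal.rpow_mul]
  norm_num

/-- The normalized indicator function of the ball of radius `ε`. -/
def ballKernel (N : ℕ) (ε : ℝ) (w : Space N) : ℝ := if ‖w‖ ≤ ε then (ε ^ N)⁻¹ else 0

lemma measurable_ballKernel (ε : ℝ) : Measurable (ballKernel N ε) :=
  Measurable.ite (measurableSet_le measurable_norm measurable_const) measurable_const
    measurable_const

lemma ballKernel_nonneg {ε : ℝ} (hε : 0 < ε) (w : Space N) : 0 ≤ ballKernel N ε w := by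
  unfold ballKernel
  split_ifs <;> positivity

/-- The factor `ε^{-N}` cancels the scaling of the volume. The mass is therefore independent of `ε`,
which makes the later L² bounds uniform. -/
lemma lintegral_ballKernel {ε : ℝ} (hε : 0 < ε) :
    ∫⁻ w, ENNReal.ofReal (ballKernel N ε w) = volume (Metric.ball (0 : Space N) 1) := by
  have h : (fun w => ENNReal.ofReal (ballKernel N ε w)) =
      (Metric.closedBall (0 : Space N) ε).indicator fun _ => ENNReal.ofReal (ε ^ N)⁻¹ := by
    funext w
    by_cases hw : ‖w‖ ≤ ε <;> simp [ballKernel, hw]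
  rw [h, lintegral_indicator_const Metric.isClosed_closedBall.measurableSet,
    Measure.addHaar_closedBall _ _ hε.le, ← mul_assoc, ← ENNReal.ofReal_mul (by positivity)]
  simp [hε.ne']

/-- The `L²` class of a test function. -/
def IsTest.toL2 {η : Space N → ℂ} (hη : IsTest η) : L2Space N := hη.memLp.toLp η

lemma IsTest.coeFn_toL2 {η : Space N → ℂ} (hη : IsTest η) : hη.toL2 =ᵐ[volume] η :=
  hη.memLp.coeFn_toLp

lemma norm_toL2_le_of_ballKernel {h : Space N → ℂ} (hh : IsTest h) (ψ g : L2Space N) {ε M : ℝ}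
    (hε : 0 < ε) (hM : 0 ≤ M)
    (hb : ∀ z, ‖h z‖ₑ ≤ ENNReal.ofReal M *
      ∫⁻ y, ENNReal.ofReal (ballKernel N ε (z - y)) * (‖ψ y‖ₑ + ‖g y‖ₑ)) :
    ‖hh.toL2‖ ≤ M * volume.real (Metric.ball (0 : Space N) 1) * (2 * (‖ψ‖ + ‖g‖)) := by
  have hm : AEMeasurable (fun y => ‖ψ y‖ₑ + ‖g y‖ₑ) :=
    (Lp.aestronglyMeasurable ψ).enorm.add (Lp.aestronglyMeasurable g).enorm
  have h1 : ∫⁻ z, ‖hh.toL2 z‖ₑ ^ 2 = ∫⁻ z, ‖h z‖ₑ ^ 2 :=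
    lintegral_congr_ae (hh.coeFn_toL2.mono fun z hz => by simp only [hz])
  have h2 : ∫⁻ z, ‖h z‖ₑ ^ 2 ≤ ENNReal.ofReal M ^ 2 *
      (volume (Metric.ball (0 : Space N) 1) ^ 2 * ∫⁻ y, (‖ψ y‖ₑ + ‖g y‖ₑ) ^ 2) := by
    calc ∫⁻ z, ‖h z‖ₑ ^ 2 ≤ ∫⁻ z, ENNReal.ofReal M ^ 2 *
          (∫⁻ y, ENNReal.ofReal (ballKernel N ε (z - y)) * (‖ψ y‖ₑ + ‖g y‖ₑ)) ^ 2 :=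
          lintegral_mono fun z => by
            rw [← mul_pow]
            exact pow_le_pow_left' (hb z) 2
      _ = ENNReal.ofReal M ^ 2 * ∫⁻ z,
          (∫⁻ y, ENNReal.ofReal (ballKernel N ε (z - y)) * (‖ψ y‖ₑ + ‖g y‖ₑ)) ^ 2 :=
          lintegral_const_mul' _ _ (by simp)
      _ ≤ _ := by
          gcongr
          rw [← lintegral_ballKernel hε]
          exact lintegral_sq_convolution_le (measurable_ballKernel ε).ennreal_ofReal hm
  -- The factor 2 comes from `(s + t)² ≤ 2 s² + 2 t²` followed by the crude `2 s² + 2 t² ≤ (2 (s +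
  -- t))²`.
  have h3 : ∫⁻ y, (‖ψ y‖ₑ + ‖g y‖ₑ) ^ 2 ≤ ENNReal.ofReal (2 * (‖ψ‖ + ‖g‖)) ^ 2 := by
    have hp : ∀ s t : ENNReal, (s + t) ^ 2 ≤ 2 * s ^ 2 + 2 * t ^ 2 := fun s t => by
      have h := ENNReal.rpow_add_le_mul_rpow_add_rpow s t (p := 2) (by norm_num)
      norm_num [mul_add] at h
      exact h
    calc ∫⁻ y, (‖ψ y‖ₑ + ‖g y‖ₑ) ^ 2 ≤ ∫⁻ y, (2 * ‖ψ y‖ₑ ^ 2 + 2 * ‖g y‖ₑ ^ 2) :=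
          lintegral_mono fun y => hp _ _
      _ = 2 * ENNReal.ofReal ‖ψ‖ ^ 2 + 2 * ENNReal.ofReal ‖g‖ ^ 2 := by
          rw [lintegral_add_left' (((Lp.aestronglyMeasurable ψ).enorm.pow_const 2).const_mul 2),
            lintegral_const_mul' _ _ (by simp), lintegral_const_mul' _ _ (by simp),
            lintegral_enorm_sq, lintegral_enorm_sq]
      _ ≤ _ := by
          rw [← ENNReal.ofReal_pow (norm_nonneg _), ← ENNReal.ofReal_pow (norm_nonneg _),
            ← ENNReal.ofReal_pow (by positivity),
            show ∀ t : ENNReal, 2 * t = ENNReal.ofReal 2 * t by simp,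
            show ∀ t : ENNReal, 2 * t = ENNReal.ofReal 2 * t by simp,
            ← ENNReal.ofReal_mul (by norm_num), ← ENNReal.ofReal_mul (by norm_num),
            ← ENNReal.ofReal_add (by positivity) (by positivity)]
          refine ENNReal.ofReal_le_ofReal ?_
          nlinarith [norm_nonneg ψ, norm_nonneg g, mul_nonneg (norm_nonneg ψ) (norm_nonneg g)]
  have h4 : ENNReal.ofReal ‖hh.toL2‖ ^ 2 ≤ ENNReal.ofReal
      (M * volume.real (Metric.ball (0 : Space N) 1) * (2 * (‖ψ‖ + ‖g‖))) ^ 2 := by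
    rw [← lintegral_enorm_sq, h1]
    refine h2.trans ?_
    rw [ENNReal.ofReal_mul (by positivity), ENNReal.ofReal_mul hM,
      ofReal_measureReal measure_ball_lt_top.ne, mul_pow, mul_pow, mul_assoc]
    gcongr
  rw [← ENNReal.ofReal_pow (norm_nonneg _), ← ENNReal.ofReal_pow (by positivity),
    ENNReal.ofReal_le_ofReal_iff (by positivity)] at h4
  exact (sq_le_sq₀ (norm_nonneg _) (by positivity)).1 h4

/-! ### Cut-off functions and mollifiers -/

lemma exists_bump (N : ℕ) {r R : ℝ} (hr : 0 < r) (hrR : r < R) :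
    ∃ χ : Space N → ℂ, IsTest χ ∧ (∀ z, ‖z‖ ≤ r → χ z = 1) ∧
      tsupport χ ⊆ Metric.closedBall 0 R := by
  let φ : ContDiffBump (0 : Space N) := ⟨r, R, hr, hrR⟩
  refine ⟨fun z => (φ z : ℂ), ⟨Complex.ofRealCLM.contDiff.comp φ.contDiff,
    φ.hasCompactSupport.comp_left (g := Complex.ofReal) (by simp)⟩, fun z hz => ?_, ?_⟩
  · change (φ z : ℂ) = 1
    rw [φ.one_of_mem_closedBall (by simpa using hz), Complex.ofReal_one]
  · refine (closure_mono ?_).trans φ.tsupport_eq.subset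
    exact Function.support_comp_subset (g := Complex.ofReal) (by simp) φ

lemma exists_mollifier (N : ℕ) :
    ∃ ρ : Space N → ℂ, IsTest ρ ∧ ∫ z, ρ z = 1 ∧ tsupport ρ ⊆ Metric.closedBall 0 1 := by
  let φ : ContDiffBump (0 : Space N) := ⟨1 / 2, 1, by norm_num, by norm_num⟩
  refine ⟨fun z => (φ.normed volume z : ℂ), ⟨Complex.ofRealCLM.contDiff.comp φ.contDiff_normed,
    φ.hasCompactSupport_normed.comp_left (g := Complex.ofReal) (by simp)⟩, ?_, ?_⟩
  · change ∫ z, (φ.normed volume z : ℂ) = 1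
    rw [integral_complex_ofReal, φ.integral_normed, Complex.ofReal_one]
  · refine (closure_mono ?_).trans (φ.tsupport_normed_eq (μ := volume)).subset
    exact Function.support_comp_subset (g := Complex.ofReal) (by simp) (φ.normed volume)

lemma IsTest.exists_bound {η : Space N → ℂ} (hη : IsTest η) : ∃ M, ∀ z, ‖η z‖ ≤ M :=
  hη.2.exists_bound_of_continuous hη.1.continuous

lemma tsupport_partialDeriv_subset (f : Space N → ℂ) (i : Fin N) :
    tsupport (partialDeriv i f) ⊆ tsupport f :=
  tsupport_fderiv_apply_subset ℝ (f := f) (e i)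

lemma eq_zero_of_tsupport_subset {f : Space N → ℂ} {R : ℝ}
    (hf : tsupport f ⊆ Metric.closedBall 0 R) {z : Space N} (hz : R < ‖z‖) : f z = 0 :=
  image_eq_zero_of_notMem_tsupport fun h => by
    have := hf h
    rw [mem_closedBall_zero_iff] at this
    linarith

/-- A common bound for a test function and its partial derivatives of order at most two. -/
lemma IsTest.exists_bound_deriv {η : Space N → ℂ} (hη : IsTest η) :
    ∃ M, 0 ≤ M ∧ (∀ z, ‖η z‖ ≤ M) ∧ (∀ i z, ‖BlochHom.partialDeriv i η z‖ ≤ M) ∧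
      ∀ i j z, ‖BlochHom.partialDeriv i (BlochHom.partialDeriv j η) z‖ ≤ M := by
  obtain ⟨M0, h0⟩ := hη.exists_bound
  choose M1 h1 using fun i => (hη.partialDeriv i).exists_bound
  choose M2 h2 using fun i j => ((hη.partialDeriv j).partialDeriv i).exists_bound
  have p0 : 0 ≤ M0 := (norm_nonneg _).trans (h0 0)
  have p1 : ∀ i, 0 ≤ M1 i := fun i => (norm_nonneg _).trans (h1 i 0)
  have p2 : ∀ i j, 0 ≤ M2 i j := fun i j => (norm_nonneg _).trans (h2 i j 0)
  have q1 : 0 ≤ ∑ i, M1 i := Finset.sum_nonneg fun i _ => p1 i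
  have q2 : 0 ≤ ∑ i, ∑ j, M2 i j := Finset.sum_nonneg fun i _ => Finset.sum_nonneg fun j _ => p2 i j
  refine ⟨M0 + ∑ i, M1 i + ∑ i, ∑ j, M2 i j, by positivity, fun z => ?_, fun i z => ?_,
    fun i j z => ?_⟩
  · linarith [h0 z]
  · linarith [h1 i z, Finset.single_le_sum (fun i _ => p1 i) (Finset.mem_univ i)]
  · linarith [h2 i j z, Finset.single_le_sum (fun j _ => p2 i j) (Finset.mem_univ j),
      Finset.single_le_sum (f := fun i => ∑ j, M2 i j)
        (fun i _ => Finset.sum_nonneg fun j _ => p2 i j) (Finset.mem_univ i)]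

/-! ### The commutator of the operator with a cut-off -/

lemma partialDeriv_translate {f : Space N → ℂ} (hf : ContDiff ℝ ∞ f) (y : Space N) (i : Fin N) :
    partialDeriv i (fun z => f (z - y)) = fun z => partialDeriv i f (z - y) := by
  funext z
  have h := ((hf.differentiable (by simp) (z - y)).hasFDerivAt.comp z
    ((hasFDerivAt_id z).sub_const y)).fderiv
  exact (DFunLike.congr_fun h (e i)).trans (by simp [partialDeriv])

/-- Leibniz rule, sorted by the order of the derivatives falling on `u`. Symmetry of `a` is not
assumed, whence the sums `a i j + a j i`. -/
lemma transposeOp_mul (a : Matrix (Fin N) (Fin N) ℝ) (b : Matrix (Fin N) (Fin N) ℂ) (c : ℂ)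
    (d : Matrix (Fin N) (Fin N) ℝ) {χ u : Space N → ℂ} (hχ : ContDiff ℝ ∞ χ)
    (hu : ContDiff ℝ ∞ u) (z : Space N) :
    transposeOp a b c d (fun z => χ z * u z) z =
      (transposeOp a b c d χ z) * u z
      + (∑ i, (-(∑ j, ((a i j : ℂ) + a j i) * partialDeriv j χ z) - linForm b i z * χ z)
          * partialDeriv i u z)
      + ∑ i, ∑ j, (-(a i j : ℂ) * χ z) * partialDeriv i (partialDeriv j u) z := by
  have h2 : ∀ i j, partialDeriv i (partialDeriv j fun z => χ z * u z) z =
      partialDeriv i (partialDeriv j χ) z * u z + partialDeriv j χ z * partialDeriv i u z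
        + partialDeriv i χ z * partialDeriv j u z + χ z * partialDeriv i (partialDeriv j u) z := by
    intro i j
    rw [partialDeriv_mul hχ hu j, partialDeriv_add ((contDiff_partialDeriv hχ j).mul hu)
      (hχ.mul (contDiff_partialDeriv hu j)), partialDeriv_mul (contDiff_partialDeriv hχ j) hu,
      partialDeriv_mul hχ (contDiff_partialDeriv hu j)]
    ring
  have h1 : ∀ i, partialDeriv i (fun z => χ z * u z) z =
      partialDeriv i χ z * u z + χ z * partialDeriv i u z := fun i => by
    rw [partialDeriv_mul hχ hu i]
  have s : ∑ i, ∑ j, (a j i : ℂ) * partialDeriv j χ z * partialDeriv i u z =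
      ∑ i, ∑ j, (a i j : ℂ) * partialDeriv i χ z * partialDeriv j u z := Finset.sum_comm
  rw [transposeOp_eq, transposeOp_eq]
  simp only [h1, h2, mul_add, Finset.sum_add_distrib, add_mul,
    sub_mul, neg_mul, Finset.sum_sub_distrib, Finset.sum_neg_distrib, Finset.sum_mul]
  rw [s]
  simp only [← mul_assoc]
  simp only [mul_right_comm _ (χ z)]
  ring

/-! ### Convolution with a test function -/

/-- The convolution `z ↦ ∫ ψ(y) ρ(z - y) dy`. -/
def mollify (ψ : L2Space N) (ρ : Space N → ℂ) (z : Space N) : ℂ := ∫ y, ψ y * ρ (z - y)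

lemma mollify_eq_convolution (ψ : L2Space N) (ρ : Space N → ℂ) :
    mollify ψ ρ = convolution ψ ρ (ContinuousLinearMap.mul ℝ ℂ) volume := rfl

lemma locallyIntegrable_coeFn (ψ : L2Space N) : LocallyIntegrable (ψ : Space N → ℂ) volume :=
  (Lp.memLp ψ).locallyIntegrable (by norm_num)

lemma contDiff_mollify (ψ : L2Space N) {ρ : Space N → ℂ} (hρ : IsTest ρ) :
    ContDiff ℝ ∞ (mollify ψ ρ) := by
  rw [mollify_eq_convolution]
  exact hρ.2.contDiff_convolution_right _ (locallyIntegrable_coeFn ψ) hρ.1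

lemma partialDeriv_mollify (ψ : L2Space N) {ρ : Space N → ℂ} (hρ : IsTest ρ) (i : Fin N) :
    partialDeriv i (mollify ψ ρ) = mollify ψ (partialDeriv i ρ) := by
  funext z
  have h := hρ.2.hasFDerivAt_convolution_right (ContinuousLinearMap.mul ℝ ℂ)
    (locallyIntegrable_coeFn ψ) (hρ.1.of_le (by simp)) z
  unfold partialDeriv
  rw [mollify_eq_convolution, h.fderiv]
  have hc : HasCompactSupport (fderiv ℝ ρ) := hρ.2.fderiv (𝕜 := ℝ)
  have hcont : Continuous (fderiv ℝ ρ) := hρ.1.continuous_fderiv (by simp)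
  exact convolution_precompR_apply (ContinuousLinearMap.mul ℝ ℂ)
    (locallyIntegrable_coeFn ψ) hc hcont z (e i)

lemma integrable_mul_translate (ψ : L2Space N) {ρ : Space N → ℂ} (hρ : IsTest ρ) (z : Space N) :
    Integrable fun y => ψ y * ρ (z - y) :=
  integrable_mul_of_compact ψ (hρ.comp_sub z).1.continuous (hρ.comp_sub z).2

/-- All derivatives of the convolution fall on `ρ`, so the expression in `z` passes under the
integral. Integrability is recorded because the integral is split afterwards. -/
lemma transposeOp_mul_mollify (a : Matrix (Fin N) (Fin N) ℝ) (b : Matrix (Fin N) (Fin N) ℂ) (c : ℂ)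
    (d : Matrix (Fin N) (Fin N) ℝ) {χ ρ : Space N → ℂ} (hχ : ContDiff ℝ ∞ χ) (hρ : IsTest ρ)
    (ψ : L2Space N) (z : Space N) :
    Integrable (fun y => ψ y * transposeOp a b c d (fun z => χ z * ρ (z - y)) z) ∧
    transposeOp a b c d (fun z => χ z * mollify ψ ρ z) z =
      ∫ y, ψ y * transposeOp a b c d (fun z => χ z * ρ (z - y)) z := by
  have hρ1 := fun i => hρ.partialDeriv i
  have hρ2 := fun i j => (hρ.partialDeriv j).partialDeriv i
  set α0 := transposeOp a b c d χ z
  set α1 := fun i => -(∑ j, ((a i j : ℂ) + a j i) * partialDeriv j χ z) - linForm b i z * χ z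
    with hα1
  set α2 := fun i j => -(a i j : ℂ) * χ z with hα2
  have e1 : ∀ y, ψ y * transposeOp a b c d (fun z => χ z * ρ (z - y)) z =
      α0 * (ψ y * ρ (z - y)) + ∑ i, α1 i * (ψ y * partialDeriv i ρ (z - y))
        + ∑ i, ∑ j, α2 i j * (ψ y * partialDeriv i (partialDeriv j ρ) (z - y)) := by
    intro y
    have hs : ContDiff ℝ ∞ fun z => ρ (z - y) := hρ.1.comp (contDiff_id.sub contDiff_const)
    rw [transposeOp_mul a b c d hχ hs]
    simp only [partialDeriv_translate hρ.1, partialDeriv_translate (hρ1 _).1, mul_add,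
      Finset.mul_sum]
    simp only [mul_left_comm (ψ y)]
    rfl
  have e2 : transposeOp a b c d (fun z => χ z * mollify ψ ρ z) z =
      α0 * mollify ψ ρ z + ∑ i, α1 i * mollify ψ (partialDeriv i ρ) z
        + ∑ i, ∑ j, α2 i j * mollify ψ (partialDeriv i (partialDeriv j ρ)) z := by
    rw [transposeOp_mul a b c d hχ (contDiff_mollify ψ hρ)]
    simp only [partialDeriv_mollify ψ hρ, partialDeriv_mollify ψ (hρ1 _)]
    rfl
  have i0 := (integrable_mul_translate ψ hρ z).const_mul α0
  have i1 := fun i => (integrable_mul_translate ψ (hρ1 i) z).const_mul (α1 i)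
  have i2 := fun i j => (integrable_mul_translate ψ (hρ2 i j) z).const_mul (α2 i j)
  have s1 := integrable_finsetSum Finset.univ fun i _ => i1 i
  have s2 := integrable_finsetSum Finset.univ fun i _ =>
    integrable_finsetSum Finset.univ fun j _ => i2 i j
  have s01 : Integrable fun y => α0 * (ψ y * ρ (z - y)) +
    ∑ i, α1 i * (ψ y * partialDeriv i ρ (z - y)) := i0.add s1
  refine ⟨(s01.add s2).congr (Filter.Eventually.of_forall fun y => (e1 y).symm), ?_⟩
  rw [e2, integral_congr_ae (Filter.Eventually.of_forall e1), integral_add s01 s2,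
    integral_add i0 s1, integral_finsetSum _ fun i _ => i1 i,
    integral_finsetSum _ fun i _ => integrable_finsetSum Finset.univ fun j _ => i2 i j]
  simp only [integral_finsetSum _ fun j _ => i2 _ j, integral_const_mul, mollify]

/-- The kernel of the commutator of the differential expression with `ψ ↦ χ (ρ ∗ ψ)`. -/
def commKernel (a : Matrix (Fin N) (Fin N) ℝ) (b : Matrix (Fin N) (Fin N) ℂ) (c c' : ℂ)
    (d : Matrix (Fin N) (Fin N) ℝ) (χ ρ : Space N → ℂ) (z y : Space N) : ℂ :=
  (∑ i, (χ z * linForm b i (z - y) - ∑ j, ((a i j : ℂ) + a j i) * partialDeriv j χ z)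
      * partialDeriv i ρ (z - y))
    + ((∑ i, linForm b i z * partialDeriv i χ z)
        - (∑ i, ∑ j, (a i j : ℂ) * partialDeriv i (partialDeriv j χ) z)
        + (c' - c) * χ z + (quadForm d z - quadForm d y) * χ z) * ρ (z - y)

lemma linForm_sub (b : Matrix (Fin N) (Fin N) ℂ) (i : Fin N) (z y : Space N) :
    linForm b i (z - y) = linForm b i z - linForm b i y := by
  simp [linForm, mul_sub, Finset.sum_sub_distrib]

/-- Second derivatives of `ρ(z - y)` in `z` and in `y` agree and cancel; first derivatives have
opposite signs, so `-b` at `z` and `b` at `y` combine into `b (z - y)`. What remains of the growing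
coefficients is multiplied by a derivative of `χ` or is a difference between `z` and `y`. -/
lemma commKernel_eq (a : Matrix (Fin N) (Fin N) ℝ) (b : Matrix (Fin N) (Fin N) ℂ) (c c' : ℂ)
    (d : Matrix (Fin N) (Fin N) ℝ) {χ ρ : Space N → ℂ} (hχ : ContDiff ℝ ∞ χ) (hρ : IsTest ρ)
    (z y : Space N) :
    commKernel a b c c' d χ ρ z y =
      transposeOp a (-b) c' d (fun z => χ z * ρ (z - y)) z
        - χ z * transposeOp a b c d (fun y => ρ (z - y)) y := by
  have hs : ContDiff ℝ ∞ fun z => ρ (z - y) := hρ.1.comp (contDiff_id.sub contDiff_const)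
  have h1 : ∀ j, partialDeriv j (fun y => ρ (z - y)) = fun y => -1 * partialDeriv j ρ (z - y) :=
    fun j => by rw [partialDeriv_comp_sub hρ.1]; simp
  have h2 : ∀ i j, partialDeriv i (partialDeriv j fun y => ρ (z - y)) y =
      partialDeriv i (partialDeriv j ρ) (z - y) := fun i j => by
    rw [h1, partialDeriv_const_mul ((hρ.partialDeriv j).comp_sub z).1,
      partialDeriv_comp_sub (hρ.partialDeriv j).1]
    simp
  rw [transposeOp_mul a (-b) c' d hχ hs, transposeOp_eq _ _ _ _ (fun y => ρ (z - y)),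
    transposeOp_eq _ _ _ _ χ, commKernel]
  simp only [h2]
  simp only [h1, partialDeriv_translate hρ.1, partialDeriv_translate (hρ.partialDeriv _).1,
    linForm_sub, linForm_neg, sub_mul, add_mul, Finset.sum_sub_distrib, mul_sub, neg_mul,
    Finset.sum_neg_distrib, mul_add, Finset.mul_sum, Finset.sum_add_distrib, Finset.sum_mul, one_mul,
    mul_neg]
  simp only [← mul_assoc, mul_comm _ (χ z)]
  ring

/-- For fixed `z` the function `y ↦ ρ(z - y)` is a test function, so the weak equation replaces its
pairing with `ψ` by one with `g`; only the commutator is left over. -/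
lemma transposeOp_mollify_eq (a : Matrix (Fin N) (Fin N) ℝ) (b : Matrix (Fin N) (Fin N) ℂ)
    (c c' : ℂ) (d : Matrix (Fin N) (Fin N) ℝ) {χ ρ : Space N → ℂ} (hχ : ContDiff ℝ ∞ χ)
    (hρ : IsTest ρ) {ψ g : L2Space N} (h : DistribEq a b c d ψ g) (z : Space N) :
    transposeOp a (-b) c' d (fun z => χ z * mollify ψ ρ z) z =
      ∫ y, (ψ y * commKernel a b c c' d χ ρ z y + g y * (χ z * ρ (z - y))) := by
  obtain ⟨hi, he⟩ := transposeOp_mul_mollify a (-b) c' d hχ hρ ψ z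
  have ht := (hρ.comp_sub z).transposeOp a b c d
  have i1 := (integrable_mul_of_compact ψ ht.1.continuous ht.2).const_mul (χ z)
  have i2 := (integrable_mul_translate g hρ z).const_mul (χ z)
  have e1 : ∀ y, ψ y * commKernel a b c c' d χ ρ z y + g y * (χ z * ρ (z - y)) =
      (ψ y * transposeOp a (-b) c' d (fun z => χ z * ρ (z - y)) z
        - χ z * (ψ y * transposeOp a b c d (fun y => ρ (z - y)) y)) + χ z * (g y * ρ (z - y)) :=
    fun y => by rw [commKernel_eq a b c c' d hχ hρ]; ring
  rw [integral_congr_ae (Filter.Eventually.of_forall e1), integral_add (hi.sub' i1) i2,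
    integral_sub hi i1, integral_const_mul, integral_const_mul, h _ (hρ.comp_sub z), he]
  ring

/-! ### Rescaled cut-offs and mollifiers -/

/-- The cut-off `χ(ε z)`. -/
def scaledCutoff (χ : Space N → ℂ) (ε : ℝ) (z : Space N) : ℂ := χ (ε • z)

/-- The mollifier `ε^{-N} ρ(z / ε)`. -/
def scaledMollifier (ρ : Space N → ℂ) (ε : ℝ) (z : Space N) : ℂ :=
  ((ε ^ N)⁻¹ : ℝ) * ρ (ε⁻¹ • z)

lemma IsTest.scaledCutoff {χ : Space N → ℂ} (hχ : IsTest χ) {ε : ℝ} (hε : ε ≠ 0) :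
    IsTest (scaledCutoff χ ε) := hχ.comp_smul hε

lemma IsTest.scaledMollifier {ρ : Space N → ℂ} (hρ : IsTest ρ) {ε : ℝ} (hε : ε ≠ 0) :
    IsTest (scaledMollifier ρ ε) := (hρ.comp_smul (inv_ne_zero hε)).mul_left contDiff_const

lemma partialDeriv_scaledCutoff {χ : Space N → ℂ} (hχ : IsTest χ) (ε : ℝ) (i : Fin N) :
    partialDeriv i (scaledCutoff χ ε) = fun z => ε * scaledCutoff (partialDeriv i χ) ε z :=
  partialDeriv_comp_smul hχ.1 ε i

lemma partialDeriv_partialDeriv_scaledCutoff {χ : Space N → ℂ} (hχ : IsTest χ) (ε : ℝ)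
    (i j : Fin N) :
    partialDeriv i (partialDeriv j (scaledCutoff χ ε)) =
      fun z => ε * (ε * scaledCutoff (partialDeriv i (partialDeriv j χ)) ε z) := by
  have h : ContDiff ℝ ∞ (scaledCutoff (partialDeriv j χ) ε) :=
    (hχ.partialDeriv j).1.comp (contDiff_const_smul ε)
  rw [partialDeriv_scaledCutoff hχ, partialDeriv_const_mul h,
    partialDeriv_scaledCutoff (hχ.partialDeriv j)]

lemma partialDeriv_scaledMollifier {ρ : Space N → ℂ} (hρ : IsTest ρ) (ε : ℝ) (i : Fin N) :
    partialDeriv i (scaledMollifier ρ ε) =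
      fun z => ((ε⁻¹ : ℝ) : ℂ) * scaledMollifier (partialDeriv i ρ) ε z := by
  have h : ContDiff ℝ ∞ fun z => ρ (ε⁻¹ • z) := hρ.1.comp (contDiff_const_smul ε⁻¹)
  unfold scaledMollifier
  rw [partialDeriv_const_mul h, partialDeriv_comp_smul hρ.1]
  funext z
  ring

lemma norm_scaledMollifier_le {ρ : Space N → ℂ} (hρ : tsupport ρ ⊆ Metric.closedBall 0 1) {M : ℝ}
    (hM : ∀ z, ‖ρ z‖ ≤ M) {ε : ℝ} (hε : 0 < ε) (w : Space N) :
    ‖scaledMollifier ρ ε w‖ ≤ M * ballKernel N ε w := by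
  unfold scaledMollifier ballKernel
  split_ifs with h
  · rw [norm_mul, Complex.norm_real, Real.norm_of_nonneg (by positivity), mul_comm]
    gcongr
    exact hM _
  · rw [eq_zero_of_tsupport_subset hρ]
    · simp
    · rw [norm_smul, norm_inv, Real.norm_of_nonneg hε.le, lt_inv_mul_iff₀ hε, mul_one]
      exact not_le.1 h

/-! ### Uniform bound on the commutator kernel. -/

lemma norm_coord_le (z : Space N) (i : Fin N) : ‖(z i : ℂ)‖ ≤ ‖z‖ := by
  rw [Complex.norm_real]
  exact PiLp.norm_apply_le z i

lemma norm_linForm_le (b : Matrix (Fin N) (Fin N) ℂ) (i : Fin N) (z : Space N) :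
    ‖linForm b i z‖ ≤ (∑ j, ‖b i j‖) * ‖z‖ := by
  unfold linForm
  rw [Finset.sum_mul]
  refine norm_sum_le_of_le _ fun j _ => ?_
  rw [norm_mul]
  gcongr
  exact norm_coord_le z j

lemma norm_quadForm_sub_le (d : Matrix (Fin N) (Fin N) ℝ) (z y : Space N) :
    ‖quadForm d z - quadForm d y‖ ≤ (∑ i, ∑ j, ‖d i j‖) * (‖z - y‖ * (‖z‖ + ‖y‖)) := by
  unfold quadForm
  rw [← Finset.sum_sub_distrib, Finset.sum_mul]
  refine norm_sum_le_of_le _ fun i _ => ?_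
  rw [← Finset.sum_sub_distrib, Finset.sum_mul]
  refine norm_sum_le_of_le _ fun j _ => ?_
  have h : (d i j : ℂ) * (z j : ℂ) * (z i : ℂ) - (d i j : ℂ) * (y j : ℂ) * (y i : ℂ) =
      (d i j : ℂ) * ((z j : ℂ) * ((z - y) i : ℝ) + ((z - y) j : ℝ) * (y i : ℂ)) := by
    simp only [PiLp.sub_apply, Complex.ofReal_sub]
    ring
  rw [h, norm_mul, Complex.norm_real]
  gcongr
  refine (norm_add_le _ _).trans ?_
  rw [norm_mul, norm_mul]
  have h1 := mul_le_mul (norm_coord_le z j) (norm_coord_le (z - y) i) (norm_nonneg _) (norm_nonneg _)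
  have h2 := mul_le_mul (norm_coord_le (z - y) j) (norm_coord_le y i) (norm_nonneg _) (norm_nonneg _)
  linarith

/-- Using a single `ε` balances every term. A derivative of the mollifier costs `ε⁻¹`, compensated
by a derivative of the cut-off, of size `ε`, or by `|z - y| ≤ ε`. The same two factors compensate
the growth of the coefficients, because `|z| ≤ 2/ε` on the support of the cut-off. -/
lemma exists_commKernel_bound (a : Matrix (Fin N) (Fin N) ℝ) (b : Matrix (Fin N) (Fin N) ℂ)
    (c c' : ℂ) (d : Matrix (Fin N) (Fin N) ℝ) {χ ρ : Space N → ℂ} (hχ : IsTest χ) (hρ : IsTest ρ)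
    (hχs : tsupport χ ⊆ Metric.closedBall 0 2) (hρs : tsupport ρ ⊆ Metric.closedBall 0 1) :
    ∃ K, 0 ≤ K ∧ ∀ ε : ℝ, 0 < ε → ε ≤ 1 → ∀ z y,
      ‖commKernel a b c c' d (scaledCutoff χ ε) (scaledMollifier ρ ε) z y‖ ≤
        K * ballKernel N ε (z - y) := by
  obtain ⟨P, hP, p0, p1, p2⟩ := hχ.exists_bound_deriv
  obtain ⟨Q, hQ, q0, q1, -⟩ := hρ.exists_bound_deriv
  set B := fun i => ∑ j, ‖b i j‖ with hB
  have hB0 : ∀ i, 0 ≤ B i := fun i => Finset.sum_nonneg fun j _ => norm_nonneg _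
  set Λ := ∑ i, ∑ j, ‖d i j‖ with hΛ
  have hΛ0 : 0 ≤ Λ := Finset.sum_nonneg fun i _ => Finset.sum_nonneg fun j _ => norm_nonneg _
  -- `K1` bounds the terms with a derivative of `ρ`, `K2` those with `ρ` itself. The 2 bounds `ε
  -- ‖z‖`, and the 5 comes from `ε (2 ‖z‖ + ε) ≤ 4 + 1`.
  set K1 := ∑ i, (P * B i + ∑ j, ‖(a i j : ℂ) + a j i‖ * P) * Q with hK1
  set K2 := ((∑ i, B i * 2 * P) + (∑ i, ∑ j, ‖(a i j : ℂ)‖ * P) + ‖c' - c‖ * P + Λ * 5 * P) * Q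
    with hK2
  have hK1' : 0 ≤ K1 := Finset.sum_nonneg fun i _ => by
    have := hB0 i
    positivity
  have hK2' : 0 ≤ K2 := by
    have : 0 ≤ ∑ i, B i * 2 * P := Finset.sum_nonneg fun i _ => by
      have := hB0 i
      positivity
    positivity
  refine ⟨K1 + K2, by positivity, fun ε hε hε1 z y => ?_⟩
  have hker := ballKernel_nonneg hε (z - y)
  have hρ1s : ∀ i, tsupport (partialDeriv i ρ) ⊆ Metric.closedBall 0 1 := fun i =>
    (tsupport_partialDeriv_subset ρ i).trans hρs
  have r0 := norm_scaledMollifier_le hρs q0 hε (z - y)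
  have r1 := fun i => norm_scaledMollifier_le (hρ1s i) (q1 i) hε (z - y)
  unfold commKernel
  simp only [partialDeriv_partialDeriv_scaledCutoff hχ]
  simp only [partialDeriv_scaledMollifier hρ, partialDeriv_scaledCutoff hχ]
  by_cases hw : ‖z - y‖ ≤ ε
  swap
  · have hk : ballKernel N ε (z - y) = 0 := if_neg hw
    have r0' : scaledMollifier ρ ε (z - y) = 0 := norm_le_zero_iff.1 (by simpa [hk] using r0)
    have r1' : ∀ i, scaledMollifier (partialDeriv i ρ) ε (z - y) = 0 := fun i =>
      norm_le_zero_iff.1 (by simpa [hk] using r1 i)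
    simp [r0', r1', hk]
  by_cases hz : ε * ‖z‖ ≤ 2
  swap
  · have hz' : 2 < ‖ε • z‖ := by
      rw [norm_smul, Real.norm_of_nonneg hε.le]
      exact not_le.1 hz
    have c0 : scaledCutoff χ ε z = 0 := eq_zero_of_tsupport_subset hχs hz'
    have c1 : ∀ i, scaledCutoff (partialDeriv i χ) ε z = 0 := fun i =>
      eq_zero_of_tsupport_subset ((tsupport_partialDeriv_subset χ i).trans hχs) hz'
    have c2 : ∀ i j, scaledCutoff (partialDeriv i (partialDeriv j χ)) ε z = 0 := fun i j =>
      eq_zero_of_tsupport_subset (((tsupport_partialDeriv_subset _ i).trans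
        (tsupport_partialDeriv_subset χ j)).trans hχs) hz'
    simp only [c0, c1, c2, mul_zero, zero_mul, Finset.sum_const_zero, sub_zero, add_zero, norm_zero]
    positivity
  have c0 : ‖scaledCutoff χ ε z‖ ≤ P := p0 _
  have c1 : ∀ i, ‖scaledCutoff (partialDeriv i χ) ε z‖ ≤ P := fun i => p1 i _
  have c2 : ∀ i j, ‖scaledCutoff (partialDeriv i (partialDeriv j χ)) ε z‖ ≤ P := fun i j => p2 i j _
  have nε : ‖(ε : ℂ)‖ = ε := by rw [Complex.norm_real, Real.norm_of_nonneg hε.le]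
  have nε' : ‖((ε⁻¹ : ℝ) : ℂ)‖ = ε⁻¹ := by
    rw [Complex.norm_real, Real.norm_of_nonneg (by positivity)]
  rw [add_mul K1 K2]
  refine (norm_add_le _ _).trans (add_le_add ?_ ?_)
  · rw [hK1, Finset.sum_mul]
    refine norm_sum_le_of_le _ fun i _ => ?_
    have hfac : ‖scaledCutoff χ ε z * linForm b i (z - y) -
        ∑ j, ((a i j : ℂ) + a j i) * (ε * scaledCutoff (partialDeriv j χ) ε z)‖ ≤
        ε * (P * B i + ∑ j, ‖(a i j : ℂ) + a j i‖ * P) := by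
      rw [mul_add]
      refine (norm_sub_le _ _).trans (add_le_add ?_ ?_)
      · rw [norm_mul]
        calc _ ≤ P * (B i * ε) := by
              refine mul_le_mul c0 ((norm_linForm_le b i _).trans ?_) (norm_nonneg _) hP
              exact mul_le_mul_of_nonneg_left hw (hB0 i)
          _ = _ := by ring
      · rw [Finset.mul_sum]
        refine norm_sum_le_of_le _ fun j _ => ?_
        rw [norm_mul, norm_mul, nε]
        calc _ ≤ ‖(a i j : ℂ) + a j i‖ * (ε * P) := by
              gcongr
              exact c1 j
          _ = _ := by ring
    rw [norm_mul, norm_mul, nε']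
    calc _ ≤ (ε * (P * B i + ∑ j, ‖(a i j : ℂ) + a j i‖ * P)) *
          (ε⁻¹ * (Q * ballKernel N ε (z - y))) := by
          refine mul_le_mul hfac ?_ (by positivity) ((norm_nonneg _).trans hfac)
          gcongr
          exact r1 i
      _ = _ := by field_simp
  · rw [hK2, norm_mul, mul_assoc]
    have hy : ‖y‖ ≤ ‖z‖ + ε := by
      have := norm_sub_le z (z - y)
      rw [sub_sub_cancel] at this
      linarith
    refine mul_le_mul ?_ r0 (norm_nonneg _) ?_
    · refine (norm_add_le _ _).trans (add_le_add ((norm_add_le _ _).trans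
        (add_le_add ((norm_sub_le _ _).trans (add_le_add ?_ ?_)) ?_)) ?_)
      · refine norm_sum_le_of_le _ fun i _ => ?_
        rw [norm_mul, norm_mul, nε]
        calc _ ≤ (B i * ‖z‖) * (ε * P) := by
              refine mul_le_mul (norm_linForm_le b i z) ?_ (by positivity)
                (mul_nonneg (hB0 i) (norm_nonneg _))
              gcongr
              exact c1 i
          _ = B i * (ε * ‖z‖) * P := by ring
          _ ≤ _ := by
              have := hB0 i
              gcongr
      · refine norm_sum_le_of_le _ fun i _ => norm_sum_le_of_le _ fun j _ => ?_
        rw [norm_mul, norm_mul, norm_mul, nε]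
        gcongr
        calc _ ≤ 1 * (1 * P) := by
              gcongr
              exact c2 i j
          _ = P := by ring
      · rw [norm_mul]
        gcongr
      · rw [norm_mul]
        refine mul_le_mul ((norm_quadForm_sub_le d z y).trans ?_) c0 (norm_nonneg _) (by positivity)
        gcongr
        calc ‖z - y‖ * (‖z‖ + ‖y‖) ≤ ε * (‖z‖ + (‖z‖ + ε)) := by gcongr
          _ ≤ 5 := by nlinarith
    · have : 0 ≤ ∑ i, B i * 2 * P := Finset.sum_nonneg fun i _ => by
        have := hB0 i
        positivity
      positivity

open Filter Topology

/-! ### Approximation by test functions -/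

/-- The truncated mollification `z ↦ χ(ε z) (ρ_ε ∗ ψ)(z)`. -/
def truncMollify (χ ρ : Space N → ℂ) (ψ : L2Space N) (ε : ℝ) (z : Space N) : ℂ :=
  scaledCutoff χ ε z * mollify ψ (scaledMollifier ρ ε) z

lemma isTest_truncMollify {χ ρ : Space N → ℂ} (hχ : IsTest χ) (hρ : IsTest ρ) (ψ : L2Space N)
    {ε : ℝ} (hε : ε ≠ 0) : IsTest (truncMollify χ ρ ψ ε) :=
  ⟨(hχ.scaledCutoff hε).1.mul (contDiff_mollify ψ (hρ.scaledMollifier hε)),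
    (hχ.scaledCutoff hε).2.mul_right⟩

lemma enorm_integral_le_ballKernel (ψ g : L2Space N) {k l : Space N → ℂ} {M ε : ℝ} (hM : 0 ≤ M)
    {z : Space N} (hk : ∀ y, ‖k y‖ ≤ M * ballKernel N ε (z - y))
    (hl : ∀ y, ‖l y‖ ≤ M * ballKernel N ε (z - y)) :
    ‖∫ y, (ψ y * k y + g y * l y)‖ₑ ≤ ENNReal.ofReal M *
      ∫⁻ y, ENNReal.ofReal (ballKernel N ε (z - y)) * (‖ψ y‖ₑ + ‖g y‖ₑ) := by
  refine (enorm_integral_le_lintegral_enorm _).trans ?_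
  rw [← lintegral_const_mul' _ _ ENNReal.ofReal_ne_top]
  refine lintegral_mono fun y => ?_
  have key : ∀ (s t : ℂ), ‖t‖ ≤ M * ballKernel N ε (z - y) →
      ‖s * t‖ₑ ≤ ENNReal.ofReal M * (ENNReal.ofReal (ballKernel N ε (z - y)) * ‖s‖ₑ) := by
    intro s t ht
    rw [enorm_mul, ← mul_assoc, ← ENNReal.ofReal_mul hM, mul_comm]
    gcongr
    rw [← ofReal_norm]
    exact ENNReal.ofReal_le_ofReal ht
  calc _ ≤ ‖ψ y * k y‖ₑ + ‖g y * l y‖ₑ := enorm_add_le _ _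
    _ ≤ _ := add_le_add (key _ _ (hk y)) (key _ _ (hl y))
    _ = _ := by ring

/-- The approximation and its image are both integrals of `ψ` and `g` against kernels dominated by
`ballKernel`, so Young's inequality applies with a constant free of `ε`. -/
lemma exists_bound_truncMollify (a : Matrix (Fin N) (Fin N) ℝ) (b : Matrix (Fin N) (Fin N) ℂ)
    (c c' : ℂ) (d : Matrix (Fin N) (Fin N) ℝ) {χ ρ : Space N → ℂ} (hχ : IsTest χ) (hρ : IsTest ρ)
    (hχs : tsupport χ ⊆ Metric.closedBall 0 2) (hρs : tsupport ρ ⊆ Metric.closedBall 0 1)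
    {ψ g : L2Space N} (h : DistribEq a b c d ψ g) :
    ∃ C, ∀ (ε : ℝ) (hε : 0 < ε), ε ≤ 1 →
      ‖(isTest_truncMollify hχ hρ ψ hε.ne').toL2‖ ≤ C ∧
      ‖((isTest_truncMollify hχ hρ ψ hε.ne').transposeOp a (-b) c' d).toL2‖ ≤ C := by
  obtain ⟨P, p0⟩ := hχ.exists_bound
  obtain ⟨Q, q0⟩ := hρ.exists_bound
  have hP : 0 ≤ P := (norm_nonneg _).trans (p0 0)
  have hQ : 0 ≤ Q := (norm_nonneg _).trans (q0 0)
  obtain ⟨K, hK, hker⟩ := exists_commKernel_bound a b c c' d hχ hρ hχs hρs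
  have hM : 0 ≤ K + P * Q := by positivity
  refine ⟨(K + P * Q) * volume.real (Metric.ball (0 : Space N) 1) * (2 * (‖ψ‖ + ‖g‖)),
    fun ε hε hε1 => ?_⟩
  have hk := fun z y => ballKernel_nonneg hε (z - y : Space N)
  have b1 : ∀ z y, ‖commKernel a b c c' d (scaledCutoff χ ε) (scaledMollifier ρ ε) z y‖ ≤
      (K + P * Q) * ballKernel N ε (z - y) := fun z y => by
    have := hker ε hε hε1 z y
    have := mul_nonneg (mul_nonneg hP hQ) (hk z y)
    linarith
  have b2 : ∀ z y, ‖scaledCutoff χ ε z * scaledMollifier ρ ε (z - y)‖ ≤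
      (K + P * Q) * ballKernel N ε (z - y) := fun z y => by
    rw [norm_mul]
    have := mul_le_mul (p0 (ε • z)) (norm_scaledMollifier_le hρs q0 hε (z - y)) (norm_nonneg _) hP
    have h2 := mul_nonneg hK (hk z y)
    unfold scaledCutoff
    linarith
  constructor
  · refine norm_toL2_le_of_ballKernel _ ψ g hε hM fun z => ?_
    -- The null contribution of `g` gives this integral the same form as that of the image.
    have e1 : truncMollify χ ρ ψ ε z =
        ∫ y, (ψ y * (scaledCutoff χ ε z * scaledMollifier ρ ε (z - y)) + g y * 0) := by
      rw [truncMollify, mollify, ← integral_const_mul]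
      refine integral_congr_ae (Eventually.of_forall fun y => ?_)
      ring
    rw [e1]
    exact enorm_integral_le_ballKernel ψ g hM (b2 z) fun y => by
      rw [norm_zero]
      exact mul_nonneg hM (hk z y)
  · refine norm_toL2_le_of_ballKernel _ ψ g hε hM fun z => ?_
    have e1 := transposeOp_mollify_eq a b c c' d (hχ.scaledCutoff hε.ne').1
      (hρ.scaledMollifier hε.ne') h z
    unfold truncMollify
    rw [e1]
    exact enorm_integral_le_ballKernel ψ g hM (b1 z) (b2 z)

/-! ### Weak convergence of the approximation -/

/-- Integration of the mollifier `ρ_ε(z - y)` against `f(z)`. -/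
lemma integral_scaledMollifier (ρ f : Space N → ℂ) {ε : ℝ} (hε : 0 < ε) (y : Space N) :
    ∫ z, scaledMollifier ρ ε (z - y) * f z = ∫ w, ρ w * f (y + ε • w) := by
  have h1 : ∫ z, scaledMollifier ρ ε (z - y) * f z =
      ∫ z, scaledMollifier ρ ε z * f (y + z) := by
    rw [← integral_add_right_eq_self (fun z => scaledMollifier ρ ε (z - y) * f z) y]
    simp only [add_sub_cancel_right]
    simp only [add_comm]
  have h2 := Measure.integral_comp_smul (volume : Measure (Space N))
    (fun z => scaledMollifier ρ ε z * f (y + z)) ε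
  have hN : Module.finrank ℝ (Space N) = N := by simp
  rw [hN, abs_of_pos (by positivity)] at h2
  have h3 : ∀ w, scaledMollifier ρ ε (ε • w) * f (y + ε • w) =
      ((ε ^ N)⁻¹ : ℝ) • (ρ w * f (y + ε • w)) := fun w => by
    rw [scaledMollifier, inv_smul_smul₀ hε.ne', Complex.real_smul, mul_assoc]
  simp only [h3] at h2
  rw [integral_smul] at h2
  rw [h1]
  exact (smul_right_injective ℂ (by positivity : (ε ^ N)⁻¹ ≠ 0) h2).symm

/-- Fubini moves the mollification onto the test function and leaves `ψ` untouched, which prepares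
dominated convergence. -/
lemma integral_truncMollify_mul {χ ρ η : Space N → ℂ} (hχ : IsTest χ) (hρ : IsTest ρ)
    (hη : IsTest η) (hρs : tsupport ρ ⊆ Metric.closedBall 0 1) (ψ : L2Space N) {ε : ℝ}
    (hε : 0 < ε) :
    ∫ z, truncMollify χ ρ ψ ε z * η z =
      ∫ y, ψ y * ∫ w, ρ w * (χ (ε • (y + ε • w)) * η (y + ε • w)) := by
  have hf : IsTest fun z => scaledCutoff χ ε z * η z := hη.mul_left (hχ.scaledCutoff hε.ne').1
  set f := fun z => scaledCutoff χ ε z * η z with hfdef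
  have hr := hρ.scaledMollifier hε.ne'
  obtain ⟨R, hR⟩ := hf.2.isBounded.subset_closedBall (0 : Space N)
  have hfR : ∀ z, R < ‖z‖ → f z = 0 := fun z hz => eq_zero_of_tsupport_subset hR hz
  have hrR : ∀ w, ε < ‖w‖ → scaledMollifier ρ ε w = 0 := fun w hw => by
    rw [scaledMollifier, eq_zero_of_tsupport_subset hρs, mul_zero]
    rwa [norm_smul, norm_inv, Real.norm_of_nonneg hε.le, lt_inv_mul_iff₀ hε, mul_one]
  -- `ψ` is only locally integrable. Cutting it off at radius `R + ε` loses nothing, since `f` lives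
  -- in radius `R` and the mollifier in radius `ε`.
  set K := Metric.closedBall (0 : Space N) (R + ε) with hKdef
  have hψK : Integrable (K.indicator ψ) :=
    ((locallyIntegrable_coeFn ψ).integrableOn_isCompact
      (isCompact_closedBall 0 (R + ε))).integrable_indicator measurableSet_closedBall
  have hint : Integrable (fun p : Space N × Space N =>
      ψ p.2 * (scaledMollifier ρ ε (p.1 - p.2) * f p.1)) (volume.prod volume) := by
    obtain ⟨M, hM⟩ := hr.exists_bound
    have i1 : Integrable (fun p : Space N × Space N => f p.1 * K.indicator ψ p.2)
        (volume.prod volume) :=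
      Integrable.mul_prod (hf.1.continuous.integrable_of_hasCompactSupport hf.2) hψK
    have i2 : Integrable (fun p : Space N × Space N =>
        scaledMollifier ρ ε (p.1 - p.2) * (f p.1 * K.indicator ψ p.2)) (volume.prod volume) :=
      i1.bdd_mul (hr.1.continuous.comp (continuous_fst.sub continuous_snd)).aestronglyMeasurable
        (Eventually.of_forall fun p => hM _)
    refine i2.congr (Eventually.of_forall fun p => ?_)
    by_cases hp : p.2 ∈ K
    · simp only [Set.indicator_of_mem hp]
      ring
    · have : f p.1 = 0 ∨ scaledMollifier ρ ε (p.1 - p.2) = 0 := by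
        by_contra hcon
        rw [not_or] at hcon
        have h1 : ‖p.1‖ ≤ R := not_lt.1 fun h => hcon.1 (hfR _ h)
        have h2 : ‖p.1 - p.2‖ ≤ ε := not_lt.1 fun h => hcon.2 (hrR _ h)
        refine hp (mem_closedBall_zero_iff.2 ?_)
        have := norm_sub_le p.1 (p.1 - p.2)
        rw [sub_sub_cancel] at this
        linarith
      rcases this with h | h <;> simp [h]
  calc ∫ z, truncMollify χ ρ ψ ε z * η z
      = ∫ z, ∫ y, ψ y * (scaledMollifier ρ ε (z - y) * f z) := by
        refine integral_congr_ae (Eventually.of_forall fun z => ?_)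
        simp only [truncMollify, mollify, hfdef]
        rw [mul_right_comm, ← integral_const_mul]
        refine integral_congr_ae (Eventually.of_forall fun y => ?_)
        simp only
        ring
    _ = ∫ y, ∫ z, ψ y * (scaledMollifier ρ ε (z - y) * f z) := integral_integral_swap hint
    _ = _ := by
        refine integral_congr_ae (Eventually.of_forall fun y => ?_)
        simp only
        rw [integral_const_mul, integral_scaledMollifier ρ f hε y]
        rfl

/-- Dominated convergence is used twice. The averages `m k y` tend to `η y` because `χ 0 = 1` and
`ρ` has integral one; they are uniformly bounded and vanish outside a fixed ball, on which `ψ` is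
integrable. -/
lemma tendsto_integral_truncMollify {χ ρ η : Space N → ℂ} (hχ : IsTest χ) (hρ : IsTest ρ)
    (hη : IsTest η) (hχ1 : χ 0 = 1) (hρ1 : ∫ w, ρ w = 1)
    (hρs : tsupport ρ ⊆ Metric.closedBall 0 1) (ψ : L2Space N) {ε : ℕ → ℝ} (hε : ∀ k, 0 < ε k)
    (hε1 : ∀ k, ε k ≤ 1) (hε0 : Tendsto ε atTop (𝓝 0)) :
    Tendsto (fun k => ∫ z, truncMollify χ ρ ψ (ε k) z * η z) atTop (𝓝 (∫ z, ψ z * η z)) := by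
  simp only [integral_truncMollify_mul hχ hρ hη hρs ψ (hε _)]
  obtain ⟨P, hP⟩ := hχ.exists_bound
  obtain ⟨E, hE⟩ := hη.exists_bound
  have hP0 : 0 ≤ P := (norm_nonneg _).trans (hP 0)
  have hE0 : 0 ≤ E := (norm_nonneg _).trans (hE 0)
  obtain ⟨R, hR⟩ := hη.2.isBounded.subset_closedBall (0 : Space N)
  have iρ : Integrable ρ := hρ.1.continuous.integrable_of_hasCompactSupport hρ.2
  have hb : ∀ k y w, ‖ρ w * (χ (ε k • (y + ε k • w)) * η (y + ε k • w))‖ ≤ ‖ρ w‖ * (P * E) := by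
    intro k y w
    rw [norm_mul, norm_mul]
    exact mul_le_mul_of_nonneg_left (mul_le_mul (hP _) (hE _) (norm_nonneg _) hP0) (norm_nonneg _)
  have hcont : ∀ k, Continuous fun p : Space N × Space N =>
      ρ p.2 * (χ (ε k • (p.1 + ε k • p.2)) * η (p.1 + ε k • p.2)) := fun k => by
    have h1 := hρ.1.continuous
    have h2 := hχ.1.continuous
    have h3 := hη.1.continuous
    fun_prop
  set m : ℕ → Space N → ℂ := fun k y =>
    ∫ w, ρ w * (χ (ε k • (y + ε k • w)) * η (y + ε k • w)) with hm
  have hm_bound : ∀ k y, ‖m k y‖ ≤ (∫ w, ‖ρ w‖) * (P * E) := fun k y => by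
    rw [← integral_mul_const]
    exact norm_integral_le_of_norm_le (iρ.norm.mul_const _) (Eventually.of_forall (hb k y))
  have hm_zero : ∀ k y, R + 1 < ‖y‖ → m k y = 0 := fun k y hy => by
    refine integral_eq_zero_of_ae (Eventually.of_forall fun w => ?_)
    by_cases hw : 1 < ‖w‖
    · simp [eq_zero_of_tsupport_subset hρs hw]
    · have : η (y + ε k • w) = 0 := by
        refine eq_zero_of_tsupport_subset hR ?_
        have h1 : ‖ε k • w‖ ≤ 1 := by
          rw [norm_smul, Real.norm_of_nonneg (hε k).le]
          exact mul_le_one₀ (hε1 k) (norm_nonneg _) (not_lt.1 hw)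
        have h2 := norm_sub_le (y + ε k • w) (ε k • w)
        rw [add_sub_cancel_right] at h2
        linarith
      simp [this]
  have hm_tendsto : ∀ y, Tendsto (fun k => m k y) atTop (𝓝 (η y)) := by
    intro y
    have h : Tendsto (fun k => m k y) atTop (𝓝 (∫ w, ρ w * η y)) := by
      refine tendsto_integral_of_dominated_convergence (fun w => ‖ρ w‖ * (P * E))
        (fun k => ((hcont k).comp (Continuous.prodMk_right y)).aestronglyMeasurable)
        (iρ.norm.mul_const _) (fun k => Eventually.of_forall (hb k y))
        (Eventually.of_forall fun w => ?_)
      have t1 : Tendsto (fun k => y + ε k • w) atTop (𝓝 y) := by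
        simpa using (hε0.smul_const w).const_add y
      have t2 : Tendsto (fun k => ε k • (y + ε k • w)) atTop (𝓝 0) := by
        simpa using hε0.smul t1
      have t3 := (hχ.1.continuous.tendsto 0).comp t2
      have t4 := (hη.1.continuous.tendsto y).comp t1
      rw [hχ1] at t3
      simpa using (t3.mul t4).const_mul (ρ w)
    rwa [integral_mul_const, hρ1, one_mul] at h
  have hm_meas : ∀ k, AEStronglyMeasurable (m k) volume := fun k => by
    have := (hcont k).stronglyMeasurable.integral_prod_right' (ν := (volume : Measure (Space N)))
    exact this.aestronglyMeasurable
  set K := Metric.closedBall (0 : Space N) (R + 1) with hK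
  have hψK : Integrable (K.indicator ψ) :=
    ((locallyIntegrable_coeFn ψ).integrableOn_isCompact
      (isCompact_closedBall 0 (R + 1))).integrable_indicator measurableSet_closedBall
  refine tendsto_integral_of_dominated_convergence
    (fun y => ‖K.indicator ψ y‖ * ((∫ w, ‖ρ w‖) * (P * E)))
    (fun k => (Lp.aestronglyMeasurable ψ).mul (hm_meas k)) (hψK.norm.mul_const _)
    (fun k => Eventually.of_forall fun y => ?_)
    (Eventually.of_forall fun y => (hm_tendsto y).const_mul _)
  by_cases hy : y ∈ K
  · rw [Set.indicator_of_mem hy, norm_mul]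
    exact mul_le_mul_of_nonneg_left (hm_bound k y) (norm_nonneg _)
  · have : m k y = 0 := hm_zero k y (by simpa [hK] using hy)
    change ‖ψ y * m k y‖ ≤ _
    rw [this, mul_zero, norm_zero, Set.indicator_of_notMem hy, norm_zero, zero_mul]

/-- Every element of the maximal domain is a weak limit of test functions whose images stay
bounded. -/
lemma DistribEq.exists_approx {a : Matrix (Fin N) (Fin N) ℝ} {b : Matrix (Fin N) (Fin N) ℂ} {c : ℂ}
    {d : Matrix (Fin N) (Fin N) ℝ} {ψ g : L2Space N} (h : DistribEq a b c d ψ g) (c' : ℂ) :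
    ∃ (F : ℕ → Space N → ℂ) (hF : ∀ k, IsTest (F k)) (C : ℝ),
      (∀ k, ‖(hF k).toL2‖ ≤ C) ∧ (∀ k, ‖((hF k).transposeOp a (-b) c' d).toL2‖ ≤ C) ∧
      ∀ η, IsTest η → Tendsto (fun k => ∫ z, F k z * η z) atTop (𝓝 (∫ z, ψ z * η z)) := by
  obtain ⟨χ, hχ, hχ1, hχs⟩ := exists_bump N (r := 1) (R := 2) (by norm_num) (by norm_num)
  obtain ⟨ρ, hρ, hρ1, hρs⟩ := exists_mollifier N
  obtain ⟨C, hC⟩ := exists_bound_truncMollify a b c c' d hχ hρ hχs hρs h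
  have hε : ∀ k : ℕ, (0 : ℝ) < 1 / ((k : ℝ) + 1) := fun k => Nat.one_div_pos_of_nat
  have hε1 : ∀ k : ℕ, 1 / ((k : ℝ) + 1) ≤ 1 := fun k => by
    rw [div_le_one (by positivity)]
    linarith [(Nat.cast_nonneg k : (0 : ℝ) ≤ k)]
  exact ⟨fun k => truncMollify χ ρ ψ (1 / ((k : ℝ) + 1)),
    fun k => isTest_truncMollify hχ hρ ψ (hε k).ne', C, fun k => (hC _ (hε k) (hε1 k)).1,
    fun k => (hC _ (hε k) (hε1 k)).2, fun η hη => tendsto_integral_truncMollify hχ hρ hη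
      (hχ1 0 (by simp)) hρ1 hρs ψ hε hε1 tendsto_one_div_add_atTop_nhds_zero_nat⟩

/-! ### Symmetry and self-adjointness -/

lemma IsTest.inner_toL2 {η : Space N → ℂ} (hη : IsTest η) (φ : L2Space N) :
    inner ℂ hη.toL2 φ = ∫ z, φ z * Star.star (η z) := by
  rw [L2.inner_def]
  refine integral_congr_ae (hη.coeFn_toL2.mono fun z hz => ?_)
  simp only [hz, RCLike.inner_apply]
  rfl

lemma IsTest.integral_toL2_mul {η : Space N → ℂ} (hη : IsTest η) (ζ : Space N → ℂ) :
    ∫ z, hη.toL2 z * ζ z = ∫ z, η z * ζ z :=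
  integral_congr_ae (hη.coeFn_toL2.mono fun z hz => by simp only [hz])

lemma dense_range_toL2 (N : ℕ) : Dense {φ : L2Space N | ∃ (η : Space N → ℂ) (hη : IsTest η),
    φ = hη.toL2} := by
  refine (Lp.dense_hasCompactSupport_contDiff (μ := (volume : Measure (Space N))) (F := ℂ)
    (p := 2) ENNReal.ofNat_ne_top).mono ?_
  rintro φ ⟨η, hφ, h1, h2⟩
  exact ⟨η, ⟨h2, h1⟩, Lp.ext (hφ.trans (IsTest.coeFn_toL2 ⟨h2, h1⟩).symm)⟩

/-- A bounded sequence which converges in the sense of distributions converges weakly. -/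
lemma tendsto_inner_of_tendsto_integral_mul {F : ℕ → L2Space N} {G : L2Space N} {C : ℝ}
    (hC : ∀ k, ‖F k‖ ≤ C)
    (h : ∀ η, IsTest η → Tendsto (fun k => ∫ z, F k z * η z) atTop (𝓝 (∫ z, G z * η z)))
    (φ : L2Space N) : Tendsto (fun k => inner ℂ φ (F k)) atTop (𝓝 (inner ℂ φ G)) := by
  have hC0 : 0 ≤ C := (norm_nonneg _).trans (hC 0)
  have hpos : 0 < C + ‖G‖ + 1 := by positivity
  rw [Metric.tendsto_atTop]
  intro δ hδ
  -- The `+ 1` keeps the denominator positive even if `C` and `G` vanish.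
  obtain ⟨_, hclose, η, hη, rfl⟩ := Metric.dense_iff.1 (dense_range_toL2 N) φ
    (δ / 2 / (C + ‖G‖ + 1)) (by positivity)
  rw [Metric.mem_ball, dist_comm, dist_eq_norm] at *
  have ht := h _ hη.star
  obtain ⟨n, hn⟩ := Metric.tendsto_atTop.1 ht (δ / 2) (by positivity)
  refine ⟨n, fun k hk => ?_⟩
  have h1 := hn k hk
  rw [← hη.inner_toL2, ← hη.inner_toL2, dist_eq_norm, ← inner_sub_right] at h1
  rw [dist_eq_norm, ← inner_sub_right]
  have h2 : ‖F k - G‖ ≤ C + ‖G‖ := (norm_sub_le _ _).trans (add_le_add (hC k) le_rfl)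
  have h3 : inner ℂ φ (F k - G) = inner ℂ (φ - hη.toL2) (F k - G)
      + inner ℂ hη.toL2 (F k - G) := by rw [← inner_add_left, sub_add_cancel]
  have h4 : ‖inner ℂ (φ - hη.toL2) (F k - G)‖ ≤ δ / 2 := by
    refine (norm_inner_le_norm _ _).trans ?_
    calc ‖φ - hη.toL2‖ * ‖F k - G‖ ≤ (δ / 2 / (C + ‖G‖ + 1)) * (C + ‖G‖ + 1) := by
          gcongr
          linarith
      _ = δ / 2 := by field_simp
  rw [h3]
  have := norm_add_le (inner ℂ (φ - hη.toL2) (F k - G)) (inner ℂ hη.toL2 (F k - G))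
  linarith

section SelfAdjoint

variable {a : Matrix (Fin N) (Fin N) ℝ} {b : Matrix (Fin N) (Fin N) ℂ} {c : ℂ}
  {d : Matrix (Fin N) (Fin N) ℝ}

/-- On smooth functions the operator itself is `transposeOp a (-b) (c + b.trace) d`. The condition
on `c` makes it the conjugate of its own transpose, which is formal symmetry. -/
lemma star_transposeOp_neg (hb : ∀ i j, star (b i j) = -b i j) (hc : star c = c + b.trace)
    (η : Space N → ℂ) (z : Space N) :
    star (transposeOp a (-b) (c + b.trace) d η z) = transposeOp a b c d (fun z => star (η z)) z := by
  have h := star_transposeOp a (b := -b) (fun i j => by rw [Matrix.neg_apply, star_neg, hb]) (c + b.trace) d η z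
  rwa [neg_neg, ← hc, star_star, hc] at h

/-- The operator with its maximal domain is symmetric. -/
lemma DistribEq.inner_eq (ha : a.IsSymm) (hb : ∀ i j, star (b i j) = -b i j)
    (hc : star c = c + b.trace) {φ f ψ g : L2Space N} (hφ : DistribEq a b c d φ f)
    (hψ : DistribEq a b c d ψ g) : inner ℂ f ψ = inner ℂ φ g := by
  obtain ⟨F, hF, C, hC1, hC2, hlim⟩ := hψ.exists_approx (c + b.trace)
  have hT := fun k => (hF k).transposeOp a (-b) (c + b.trace) d
  have t1 : Tendsto (fun k => inner ℂ f (hF k).toL2) atTop (𝓝 (inner ℂ f ψ)) :=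
    tendsto_inner_of_tendsto_integral_mul hC1
      (fun η hη => by simpa only [IsTest.integral_toL2_mul] using hlim η hη) f
  -- The images tend to `g` as distributions: transposition moves the expression onto `η`, and the
  -- weak equation for `ψ` identifies the limit. Weak convergence suffices because `φ` is fixed.
  have t2 : Tendsto (fun k => inner ℂ φ (hT k).toL2) atTop (𝓝 (inner ℂ φ g)) := by
    refine tendsto_inner_of_tendsto_integral_mul hC2 (fun η hη => ?_) φ
    simp only [IsTest.integral_toL2_mul]
    rw [← hψ η hη]
    refine (hlim _ (hη.transposeOp a b c d)).congr fun k => ?_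
    exact integral_mul_transposeOp ha b c d (hF k) hη
  -- For each `k` the equality is the weak equation for `φ` tested on the conjugate of `F k`.
  refine tendsto_nhds_unique t1 (t2.congr fun k => ?_)
  rw [← inner_conj_symm, ← inner_conj_symm f, (hT k).inner_toL2, (hF k).inner_toL2,
    ← hφ _ (hF k).star]
  simp only [star_transposeOp_neg hb hc]

/-- Test functions lie in the maximal domain. This makes the domain dense and supplies the elements
against which the adjoint is tested. -/
lemma IsTest.distribEq (ha : a.IsSymm) {η : Space N → ℂ} (hη : IsTest η) :
    DistribEq a b c d hη.toL2 (hη.transposeOp a (-b) (c + b.trace) d).toL2 := by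
  intro ζ hζ
  rw [IsTest.integral_toL2_mul, IsTest.integral_toL2_mul]
  exact integral_mul_transposeOp ha b c d hη hζ

/-- Testing the adjoint relation on test functions only already gives the distributional equation,
so the adjoint is contained in the maximal operator. The other inclusion is symmetry on the full
domain. -/
theorem isSelfAdjoint_homOperator (ha : a.IsSymm) (hb : ∀ i j, star (b i j) = -b i j)
    (hc : star c = c + b.trace) : IsSelfAdjoint (homOperator a b c d) := by
  have hdense : Dense ((homOperator a b c d).domain : Set (L2Space N)) := by
    refine (dense_range_toL2 N).mono ?_
    rintro _ ⟨η, hη, rfl⟩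
    have h := (mem_graph_homOperator a b c d _ _).2 (hη.distribEq (b := b) (c := c) (d := d) ha)
    exact LinearPMap.mem_domain_of_mem_graph h
  rw [LinearPMap.isSelfAdjoint_def]
  refine LinearPMap.eq_of_eq_graph ?_
  rw [LinearPMap.adjoint_graph_eq_graph_adjoint hdense]
  ext ⟨φ, f⟩
  rw [mem_graph_homOperator, Submodule.mem_adjoint_iff]
  constructor
  · intro h η hη
    have h1 := h _ _ ((mem_graph_homOperator a b c d _ _).2
      (hη.star.distribEq (b := b) (c := c) (d := d) ha))
    rw [sub_eq_zero, IsTest.inner_toL2, IsTest.inner_toL2] at h1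
    simpa only [star_transposeOp_neg hb hc, star_star] using h1
  · intro h ψ g hψ
    rw [mem_graph_homOperator] at hψ
    rw [sub_eq_zero]
    exact hψ.inner_eq ha hb hc h

end SelfAdjoint

/-! ### The du Bois-Reymond lemma -/

/-- A smooth function with compact support in `(0, ∞)` and vanishing integral has a primitive of the
same kind. -/
lemma exists_primitive {g : ℝ → ℝ} (hg : ContDiff ℝ ∞ g) (hgc : HasCompactSupport g)
    (hgs : tsupport g ⊆ Set.Ioi 0) (h0 : ∫ t, g t = 0) :
    ∃ θ : ℝ → ℝ, ContDiff ℝ ∞ θ ∧ HasCompactSupport θ ∧ tsupport θ ⊆ Set.Ioi 0 ∧ deriv θ = g := by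
  obtain ⟨α, β, hα, hsub⟩ : ∃ α β : ℝ, 0 < α ∧ tsupport g ⊆ Set.Icc α β := by
    rcases (tsupport g).eq_empty_or_nonempty with he | hne
    · exact ⟨1, 1, one_pos, by simp [he]⟩
    · exact ⟨sInf (tsupport g), sSup (tsupport g), hgs (hgc.isCompact.sInf_mem hne), fun t ht =>
        ⟨csInf_le hgc.isCompact.bddBelow ht, le_csSup hgc.isCompact.bddAbove ht⟩⟩
  have hg0 : ∀ t, t ∉ Set.Icc α β → g t = 0 := fun t ht =>
    image_eq_zero_of_notMem_tsupport fun h => ht (hsub h)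
  have hgi : Integrable g := hg.continuous.integrable_of_hasCompactSupport hgc
  set θ : ℝ → ℝ := fun t => ∫ s in Set.Iic t, g s with hθ
  have hd : ∀ t, HasDerivAt θ (g t) t := fun t => by
    have e1 : ∀ t, θ t = (∫ s in Set.Iic (0 : ℝ), g s) + ∫ s in (0 : ℝ)..t, g s := fun t => by
      rw [← intervalIntegral.integral_Iic_sub_Iic hgi.integrableOn hgi.integrableOn]
      ring
    rw [show θ = _ from funext e1]
    exact (intervalIntegral.integral_hasDerivAt_right (hg.continuous.intervalIntegrable _ _)
      (hg.continuous.stronglyMeasurableAtFilter _ _) hg.continuous.continuousAt).const_add _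
  have hderiv : deriv θ = g := funext fun t => (hd t).deriv
  have hθ0 : ∀ t, t ∉ Set.Icc α β → θ t = 0 := by
    intro t ht
    rcases lt_or_ge t α with h | h
    · refine setIntegral_eq_zero_of_forall_eq_zero fun s hs => hg0 s fun hs' => ?_
      exact absurd hs'.1 (not_le.2 (lt_of_le_of_lt hs h))
    · have hβ : β < t := not_le.1 fun h' => ht ⟨h, h'⟩
      -- Beyond `β` the primitive equals the whole integral of `g`, which is zero.
      rw [hθ, ← h0]
      refine setIntegral_eq_integral_of_forall_compl_eq_zero fun s hs => hg0 s fun hs' => hs ?_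
      exact hs'.2.trans hβ.le
  have hsupp : tsupport θ ⊆ Set.Icc α β :=
    closure_minimal (fun t ht => by_contra fun h => ht (hθ0 t h)) isClosed_Icc
  refine ⟨θ, ?_, HasCompactSupport.of_support_subset_isCompact isCompact_Icc
    (subset_closure.trans hsupp), fun t ht => lt_of_lt_of_le hα (hsupp ht).1, hderiv⟩
  rw [contDiff_infty_iff_deriv, hderiv]
  exact ⟨fun t => (hd t).differentiableAt, hg⟩

/-- A continuous function whose distributional derivative on `(0, ∞)` vanishes is constant there. -/
lemma eq_of_integral_deriv_smul_eq_zero {H : ℝ → ℂ} (hH : Continuous H)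
    (h : ∀ θ : ℝ → ℝ, ContDiff ℝ ∞ θ → HasCompactSupport θ → tsupport θ ⊆ Set.Ioi 0 →
      ∫ t, deriv θ t • H t = 0) :
    ∃ κ, ∀ t, 0 < t → H t = κ := by
  -- A reference bump of integral one supported in `[1/2, 3/2]`. Subtracting `m σ` from a test
  -- function of integral `m` leaves the derivative of an admissible test function.
  let φ : ContDiffBump (1 : ℝ) := ⟨1 / 4, 1 / 2, by norm_num, by norm_num⟩
  set σ : ℝ → ℝ := φ.normed volume with hσ
  have σ1 : ∫ t, σ t = 1 := φ.integral_normed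
  have σs : ContDiff ℝ ∞ σ := φ.contDiff_normed
  have σc : HasCompactSupport σ := φ.hasCompactSupport_normed
  have σt : tsupport σ ⊆ Set.Ioi 0 := by
    rw [hσ, φ.tsupport_normed_eq]
    intro t ht
    have ht' : |t - 1| ≤ 1 / 2 := ht
    have := (abs_le.1 ht').1
    simp only [Set.mem_Ioi]
    linarith
  have σi : Integrable σ := σs.continuous.integrable_of_hasCompactSupport σc
  have iH : ∀ g : ℝ → ℝ, Continuous g → HasCompactSupport g → Integrable fun t => g t • H t :=
    fun g h1 h2 => (h1.smul hH).integrable_of_hasCompactSupport h2.smul_right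
  refine ⟨∫ t, σ t • H t, ?_⟩
  set κ := ∫ t, σ t • H t
  have hae := isOpen_Ioi.ae_eq_zero_of_integral_contDiff_smul_eq_zero (U := Set.Ioi (0 : ℝ))
    (f := fun t => H t - κ) (μ := volume)
    ((hH.sub continuous_const).locallyIntegrable.locallyIntegrableOn _) (fun g hg hgc hgs => by
      have gi : Integrable g := hg.continuous.integrable_of_hasCompactSupport hgc
      set m := ∫ t, g t
      have hsub : tsupport (fun t => g t - m * σ t) ⊆ Set.Ioi 0 :=
        (tsupport_sub g fun t => m * σ t).trans
          (Set.union_subset hgs ((tsupport_mul_subset_right).trans σt))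
      obtain ⟨θ, t1, t2, t3, t4⟩ := exists_primitive (hg.sub (contDiff_const.mul σs))
        (hgc.sub (σc.mul_left (f := fun _ => m))) hsub (by
          rw [integral_sub gi (σi.const_mul m), integral_const_mul, σ1, mul_one, sub_self])
      have h1 := h θ t1 t2 t3
      rw [t4] at h1
      simp only [sub_smul, mul_smul] at h1
      have iσ : Integrable fun t => m • σ t • H t := (iH σ σs.continuous σc).smul m
      rw [integral_sub (iH g hg.continuous hgc) iσ,
        integral_smul] at h1
      simp only [smul_sub]
      rw [integral_sub (iH g hg.continuous hgc) (gi.smul_const κ), integral_smul_const]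
      exact h1)
  have hres : (fun t => H t) =ᵐ[volume.restrict (Set.Ioi 0)] fun _ => κ := by
    rw [EventuallyEq, ae_restrict_iff' measurableSet_Ioi]
    filter_upwards [hae] with t ht h0
    exact sub_eq_zero.1 (ht h0)
  exact fun t ht => Measure.eqOn_open_of_ae_eq hres isOpen_Ioi hH.continuousOn
    continuousOn_const ht

lemma hasCompactSupport_ofReal {f : ℝ → ℝ} (hf : HasCompactSupport f) :
    HasCompactSupport fun t => (f t : ℂ) :=
  HasCompactSupport.comp_left (g := Complex.ofReal) hf Complex.ofReal_zero

/-- Rewriting of the weak form of `F' = i P'`. -/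
lemma integral_deriv_smul_sub_eq_zero {F G P : ℝ → ℂ} (hF : Continuous F) (hG : Continuous G)
    (hP : ∀ t, HasDerivAt P (G t) t) {θ : ℝ → ℝ} (t1 : ContDiff ℝ ∞ θ) (t2 : HasCompactSupport θ)
    (t3 : tsupport θ ⊆ Set.Ioi 0)
    (h1 : ∫ t in Set.Ioi (0 : ℝ), (-(Complex.I * (deriv θ t * F t)) + θ t * G t) = 0) :
    ∫ t, deriv θ t • (F t - Complex.I * P t) = 0 := by
  have hPc : Continuous P := continuous_iff_continuousAt.2 fun t => (hP t).continuousAt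
  have d1 : Continuous (deriv θ) := t1.continuous_deriv (by simp)
  have d2 : HasCompactSupport (deriv θ) := t2.deriv
  have hz : ∀ t, t ∉ Set.Ioi (0 : ℝ) → θ t = 0 := fun t ht =>
    image_eq_zero_of_notMem_tsupport fun h' => ht (t3 h')
  have hz' : ∀ t, t ∉ Set.Ioi (0 : ℝ) → deriv θ t = 0 := fun t ht =>
    image_eq_zero_of_notMem_tsupport fun h' => ht (t3 (tsupport_deriv_subset h'))
  have hext : ∫ t in Set.Ioi (0 : ℝ), (-(Complex.I * (deriv θ t * F t)) + θ t * G t) =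
      ∫ t, (-(Complex.I * (deriv θ t * F t)) + θ t * G t) :=
    setIntegral_eq_integral_of_forall_compl_eq_zero fun t ht => by
      rw [hz t ht, hz' t ht, Complex.ofReal_zero, zero_mul, zero_mul, mul_zero, neg_zero, add_zero]
  rw [hext] at h1
  have c1 : HasCompactSupport fun t => (θ t : ℂ) := hasCompactSupport_ofReal t2
  have c2 : HasCompactSupport fun t => ((deriv θ t : ℝ) : ℂ) := hasCompactSupport_ofReal d2
  have k1 : Continuous fun t => (θ t : ℂ) := Complex.continuous_ofReal.comp t1.continuous
  have k2 : Continuous fun t => ((deriv θ t : ℝ) : ℂ) := Complex.continuous_ofReal.comp d1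
  have iG : Integrable fun t => (θ t : ℂ) * G t :=
    (k1.mul hG).integrable_of_hasCompactSupport c1.mul_right
  have iF : Integrable fun t => ((deriv θ t : ℝ) : ℂ) * F t :=
    (k2.mul hF).integrable_of_hasCompactSupport c2.mul_right
  have iP : Integrable fun t => ((deriv θ t : ℝ) : ℂ) * P t :=
    (k2.mul hPc).integrable_of_hasCompactSupport c2.mul_right
  have iP' : Integrable fun t => (θ t : ℂ) * P t :=
    (k1.mul hPc).integrable_of_hasCompactSupport c1.mul_right
  have parts : ∫ t, (θ t : ℂ) * G t = -∫ t, ((deriv θ t : ℝ) : ℂ) * P t :=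
    integral_mul_deriv_eq_deriv_mul_of_integrable (u := fun t => (θ t : ℂ))
      (u' := fun t => ((deriv θ t : ℝ) : ℂ)) (v := P) (v' := G)
      (fun t _ => ((t1.differentiable (by simp) t).hasDerivAt).ofReal_comp)
      (fun t _ => hP t) iG iP iP'
  have iF' : Integrable fun t => -(Complex.I * (((deriv θ t : ℝ) : ℂ) * F t)) := (iF.const_mul _).neg
  rw [integral_add iF' iG, integral_neg, integral_const_mul, parts] at h1
  have e1 : ∀ t, deriv θ t • (F t - Complex.I * P t) =
      ((deriv θ t : ℝ) : ℂ) * F t - Complex.I * (((deriv θ t : ℝ) : ℂ) * P t) :=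
    fun t => by
      rw [Complex.real_smul]
      ring
  rw [integral_congr_ae (Eventually.of_forall e1), integral_sub iF (iP.const_mul _),
    integral_const_mul]
  have alg : ∀ x y : ℂ, -(Complex.I * x) + -y = 0 → x - Complex.I * y = 0 := fun x y hxy => by
    linear_combination Complex.I * hxy + x * Complex.I_sq
  exact alg _ _ h1

/-- The weak form of `F' = i G` on `(0, ∞)`. -/
lemma sub_eq_integral_of_weak {F G : ℝ → ℂ} (hF : Continuous F) (hG : Continuous G)
    (h : ∀ θ : ℝ → ℝ, ContDiff ℝ ∞ θ → HasCompactSupport θ → tsupport θ ⊆ Set.Ioi 0 →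
      ∫ t in Set.Ioi (0 : ℝ), (-(Complex.I * (deriv θ t * F t)) + θ t * G t) = 0)
    {s t : ℝ} (hs : 0 ≤ s) (ht : 0 ≤ t) : F t - F s = Complex.I * ∫ r in s..t, G r := by
  obtain ⟨P, hP⟩ : ∃ P : ℝ → ℂ, ∀ t, HasDerivAt P (G t) t :=
    ⟨fun t => ∫ r in (0 : ℝ)..t, G r, fun t =>
      intervalIntegral.integral_hasDerivAt_right (hG.intervalIntegrable _ _)
        (hG.stronglyMeasurableAtFilter _ _) hG.continuousAt⟩
  have hPc : Continuous P := continuous_iff_continuousAt.2 fun t => (hP t).continuousAt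
  have hH : Continuous fun t => F t - Complex.I * P t := hF.sub (continuous_const.mul hPc)
  obtain ⟨κ, hκ⟩ := eq_of_integral_deriv_smul_eq_zero hH fun θ t1 t2 t3 =>
    integral_deriv_smul_sub_eq_zero hF hG hP t1 t2 t3 (h θ t1 t2 t3)
  -- Test functions do not reach `t = 0`; continuity does.
  have hκ' : ∀ t, 0 ≤ t → F t - Complex.I * P t = κ := by
    intro t ht
    have : Set.EqOn (fun t => F t - Complex.I * P t) (fun _ => κ) (closure (Set.Ioi 0)) :=
      Set.EqOn.closure (fun t ht => hκ t ht) hH continuous_const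
    rw [closure_Ioi] at this
    exact this ht
  have h2 : ∫ r in s..t, G r = P t - P s :=
    intervalIntegral.integral_eq_sub_of_hasDerivAt (fun r _ => hP r) (hG.intervalIntegrable _ _)
  rw [h2]
  linear_combination hκ' t ht - hκ' s hs

/-! ### Conservation of the norm -/

section Evolution

variable {a : Matrix (Fin N) (Fin N) ℝ} {b : Matrix (Fin N) (Fin N) ℂ} {c : ℂ}
  {d : Matrix (Fin N) (Fin N) ℝ}

lemma transposeOp_const_mul {η : Space N → ℂ} (hη : IsTest η) (r : ℂ) (z : Space N) :
    transposeOp a b c d (fun z => r * η z) z = r * transposeOp a b c d η z := by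
  simp only [transposeOp_eq, partialDeriv_const_mul hη.1,
    partialDeriv_const_mul (hη.partialDeriv _).1, mul_add, mul_sub, mul_neg, Finset.mul_sum]
  simp only [mul_left_comm _ r]

lemma IsTest.integral_mul_eq_inner {η : Space N → ℂ} (hη : IsTest η) (φ : L2Space N) :
    ∫ z, φ z * η z = inner ℂ hη.star.toL2 φ := by
  rw [hη.star.inner_toL2]
  simp only [star_star]

/-- The time integral of a solution lies in the domain of the operator. -/
lemma SolvesHom.distribEq_integral {v₀ : L2Space N} {v w : ℝ → L2Space N}
    (h : SolvesHom a b c d v₀ v) (hw : Continuous w) (hvw : ∀ t, 0 ≤ t → w t = v t) {s t : ℝ}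
    (hs : 0 ≤ s) (ht : 0 ≤ t) :
    DistribEq a b c d (∫ r in s..t, w r) (-(Complex.I • (w t - w s))) := by
  intro η hη
  have hT := hη.transposeOp a b c d
  -- Testing with products `θ(t) η(z)` reduces the equation to the scalar law `F' = i G` for each
  -- fixed `η`.
  have hweak := sub_eq_integral_of_weak (F := fun t => inner ℂ hη.star.toL2 (w t))
    (G := fun t => inner ℂ hT.star.toL2 (w t)) (continuous_const.inner hw)
    (continuous_const.inner hw) (fun θ t1 t2 t3 => ?_) hs ht
  · rw [hη.integral_mul_eq_inner, hT.integral_mul_eq_inner, inner_neg_right, inner_smul_right,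
      inner_sub_right, hweak, ← mul_assoc, Complex.I_mul_I]
    have := (innerSL ℂ hT.star.toL2).intervalIntegral_comp_comm
      (hw.intervalIntegrable (μ := volume) s t)
    simp only [innerSL_apply_apply] at this
    rw [this]
    ring
  · have hηt : ContDiff ℝ ∞ fun p : ℝ × Space N => (θ p.1 : ℂ) * η p.2 :=
      (Complex.ofRealCLM.contDiff.comp (t1.comp contDiff_fst)).mul (hη.1.comp contDiff_snd)
    have hzero : ∀ p : ℝ × Space N, p ∉ tsupport θ ×ˢ tsupport η → (θ p.1 : ℂ) * η p.2 = 0 := by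
      rintro ⟨t, z⟩ hp
      by_cases h1 : t ∈ tsupport θ
      · have : η z = 0 := image_eq_zero_of_notMem_tsupport fun h2 => hp ⟨h1, h2⟩
        simp [this]
      · simp [image_eq_zero_of_notMem_tsupport h1]
    have hsub : tsupport (fun p : ℝ × Space N => (θ p.1 : ℂ) * η p.2) ⊆
        tsupport θ ×ˢ tsupport η :=
      closure_minimal (fun p hp => by_contra fun h => hp (hzero p h))
        ((isClosed_tsupport θ).prod (isClosed_tsupport η))
    have key := h.2.2 _ hηt (HasCompactSupport.intro (t2.isCompact.prod hη.2.isCompact)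
      (fun p hp => hzero p hp)) (hsub.trans (Set.prod_mono t3 (Set.subset_univ _)))
    rw [← key]
    refine setIntegral_congr_fun measurableSet_Ioi fun t ht => ?_
    have hd : ∀ z, deriv (fun s => (θ s : ℂ) * η z) t = deriv θ t * η z := fun z =>
      (((t1.differentiable (by simp) t).hasDerivAt).ofReal_comp.mul_const (η z)).deriv
    have e1 : ∀ z, v t z * (-(Complex.I * deriv (fun s => (θ s : ℂ) * η z) t)
        + transposeOp a b c d (fun z' => (θ t : ℂ) * η z') z) =
        -(Complex.I * deriv θ t) * (v t z * η z) + θ t * (v t z * transposeOp a b c d η z) := by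
      intro z
      rw [hd, transposeOp_const_mul hη]
      ring
    simp only [e1]
    rw [integral_add ((integrable_mul_of_compact _ hη.1.continuous hη.2).const_mul _)
      ((integrable_mul_of_compact _ hT.1.continuous hT.2).const_mul _), integral_const_mul,
      integral_const_mul, hη.integral_mul_eq_inner, hT.integral_mul_eq_inner, hvw t (le_of_lt ht)]
    ring

/-- The energy identity cannot be written for `v` itself, which may leave the domain and need not be
differentiable. It holds for the sliding averages of `v`, and survives the limit of small windows.
-/
theorem SolvesHom.norm_eq (ha : a.IsSymm) (hb : ∀ i j, star (b i j) = -b i j)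
    (hc : star c = c + b.trace) {v₀ : L2Space N} {v : ℝ → L2Space N}
    (h : SolvesHom a b c d v₀ v) {t : ℝ} (ht : 0 ≤ t) : ‖v t‖ = ‖v₀‖ := by
  -- Freezing `v` at its initial value for negative times makes two-sided derivatives available at
  -- `0`.
  set w : ℝ → L2Space N := fun t => v (max t 0) with hwdef
  have hw : Continuous w := h.1.comp_continuous (continuous_id.max continuous_const)
    fun t => le_max_right t 0
  have hvw : ∀ t, 0 ≤ t → w t = v t := fun t ht => by simp only [hwdef, max_eq_left ht]
  have hprim : ∀ s t, HasDerivAt (fun t => ∫ r in s..t, w r) (w t) t := fun s t =>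
    intervalIntegral.integral_hasDerivAt_right (hw.intervalIntegrable _ _)
      (hw.stronglyMeasurableAtFilter _ _) hw.continuousAt
  have hderiv : ∀ δ t, HasDerivAt (fun t => ∫ r in t..(t + δ), w r) (w (t + δ) - w t) t := by
    intro δ t
    have e1 : (fun t => ∫ r in t..(t + δ), w r) =
        fun t => (∫ r in (0 : ℝ)..(t + δ), w r) - ∫ r in (0 : ℝ)..t, w r := funext fun t =>
      (intervalIntegral.integral_interval_sub_left (hw.intervalIntegrable _ _)
        (hw.intervalIntegrable _ _)).symm
    rw [e1]
    exact (HasDerivAt.comp_add_const t δ (hprim 0 (t + δ))).sub (hprim 0 t)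
  have hconst : ∀ δ, 0 ≤ δ → ‖∫ r in t..(t + δ), w r‖ = ‖∫ r in (0 : ℝ)..(0 + δ), w r‖ := by
    intro δ hδ
    set V := fun t => ∫ r in t..(t + δ), w r with hV
    have hin : ∀ s, 0 ≤ s → HasDerivAt (fun s => inner ℂ (V s) (V s)) 0 s := by
      intro s hs
      have h1 := (hderiv δ s).inner ℂ (hderiv δ s)
      -- Symmetry of the operator, applied to `V` and its image `-i V'`, gives `⟨V, V'⟩ + ⟨V', V⟩ =
      -- 0`.
      have hD := h.distribEq_integral hw hvw hs (add_nonneg hs hδ)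
      have h2 := hD.inner_eq ha hb hc hD
      rw [inner_neg_left, inner_neg_right, inner_smul_left, inner_smul_right, Complex.conj_I] at h2
      have h3 : inner ℂ (V s) (w (s + δ) - w s) + inner ℂ (w (s + δ) - w s) (V s) = 0 := by
        have h4 := congrArg (fun x => Complex.I * x) h2
        simp only [neg_mul, mul_neg, neg_neg, ← mul_assoc, Complex.I_mul_I, one_mul] at h4
        linear_combination -h4
      rw [← h3]
      exact h1
    have heq : inner ℂ (V t) (V t) = inner ℂ (V 0) (V 0) :=
      constant_of_has_deriv_right_zero (a := 0) (b := t)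
        (fun s hs => (hin s hs.1).continuousAt.continuousWithinAt)
        (fun s hs => (hin s hs.1).hasDerivWithinAt) t ⟨ht, le_rfl⟩
    rw [inner_self_eq_norm_sq_to_K, inner_self_eq_norm_sq_to_K] at heq
    have heq' : ‖V t‖ ^ 2 = ‖V 0‖ ^ 2 := by exact_mod_cast heq
    exact (sq_eq_sq₀ (norm_nonneg _) (norm_nonneg _)).1 heq'
  have hlim : ∀ s, Tendsto (fun δ : ℝ => ‖δ⁻¹ • ∫ r in s..(s + δ), w r‖) (𝓝[>] 0) (𝓝 ‖w s‖) := by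
    intro s
    have h1 := (hasDerivAt_iff_tendsto_slope_zero.1 (hprim s s)).mono_left
      (nhdsWithin_mono 0 fun δ (hδ : δ ∈ Set.Ioi (0 : ℝ)) => ne_of_gt hδ)
    simpa using h1.norm
  have h1 : Tendsto (fun δ : ℝ => ‖δ⁻¹ • ∫ r in t..(t + δ), w r‖) (𝓝[>] 0) (𝓝 ‖w 0‖) := by
    refine (hlim 0).congr' ?_
    filter_upwards [self_mem_nhdsWithin] with δ hδ
    rw [norm_smul, norm_smul, hconst δ (le_of_lt hδ)]
  have h2 := tendsto_nhds_unique (hlim t) h1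
  rw [hvw t ht, hvw 0 le_rfl, h.2.1] at h2
  exact h2

end Evolution

/-! ### Differentiating a critical value -/

/-- If `l p = q (p, ψ p)` and `∂_u q (p, ψ p)` vanishes on the derivative of `ψ`, then
`∇ l (p) = ∂_p q (p, ψ p)`, which gains one order of regularity. -/
lemma contDiffAt_two_of_critical {E H : Type*} [NormedAddCommGroup E] [NormedSpace ℝ E]
    [NormedAddCommGroup H] [NormedSpace ℝ H] {q : E × H → ℝ} {ψ : E → H} {l : E → ℝ} {p₀ : E}
    (hq : ContDiffAt ℝ 2 q (p₀, ψ p₀)) (hψ : ContDiffAt ℝ 1 ψ p₀)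
    (hl : ∀ᶠ p in 𝓝 p₀, l p = q (p, ψ p))
    (hcrit : ∀ᶠ p in 𝓝 p₀, ∀ v, fderiv ℝ q (p, ψ p) (0, fderiv ℝ ψ p v) = 0) :
    ContDiffAt ℝ 2 l p₀ ∧
      ∀ᶠ p in 𝓝 p₀, ∀ v, fderiv ℝ l p v = fderiv ℝ q (p, ψ p) (v, 0) := by
  have hpair : ContinuousAt (fun p => (p, ψ p)) p₀ := continuousAt_id.prodMk hψ.continuousAt
  have hq' : ∀ᶠ p in 𝓝 p₀, ContDiffAt ℝ 2 q (p, ψ p) :=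
    hpair.eventually (hq.eventually (by simp))
  have hψ' : ∀ᶠ p in 𝓝 p₀, ContDiffAt ℝ 1 ψ p := hψ.eventually (by simp)
  have hd : ∀ᶠ p in 𝓝 p₀,
      HasFDerivAt l ((fderiv ℝ q (p, ψ p)).comp (ContinuousLinearMap.inl ℝ E H)) p := by
    filter_upwards [hq', hψ', hl.eventually_nhds, hcrit] with p h1 h2 h3 h4
    have k1 := (h1.differentiableAt (by simp)).hasFDerivAt
    have k2 := (h2.differentiableAt (by simp)).hasFDerivAt
    have k3 := (k1.comp p ((hasFDerivAt_id p).prodMk k2)).congr_of_eventuallyEq h3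
    refine k3.congr_fderiv (ContinuousLinearMap.ext fun v => ?_)
    have e1 : ((v, fderiv ℝ ψ p v) : E × H) = (v, 0) + (0, fderiv ℝ ψ p v) := by simp
    change fderiv ℝ q (p, ψ p) (v, fderiv ℝ ψ p v) = fderiv ℝ q (p, ψ p) (v, 0)
    rw [e1, map_add, h4 v, add_zero]
  refine ⟨?_, hd.mono fun p hp v => by rw [hp.fderiv]; rfl⟩
  have h2 : ((1 : ℕ) : WithTop ℕ∞) + 1 = 2 := by norm_num
  rw [← h2, contDiffAt_succ_iff_hasFDerivAt]
  obtain ⟨s, hs, hs'⟩ := eventually_iff_exists_mem.1 hd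
  refine ⟨_, ⟨s, hs, hs'⟩, ?_⟩
  -- The formula for the derivative of `l` involves `ψ` but not its derivative, so C¹ regularity of
  -- `ψ` makes it C¹.
  have c1 : ContDiffAt ℝ 1 (fderiv ℝ q) (p₀, ψ p₀) := hq.fderiv_right (by norm_num)
  exact (ContDiffAt.comp p₀ c1 (contDiffAt_id.prodMk hψ)).clm_comp contDiffAt_const

/-! ### The cell form through inner products of `L²` -/

/-- Multiplication of an `L²` function by an `L^∞` function. -/
def mulL (N : ℕ) : LinftyTorus N →L[ℝ] L2Torus N →L[ℝ] L2Torus N :=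
  (ContinuousLinearMap.lsmul ℝ ℝ : ℝ →L[ℝ] ℂ →L[ℝ] ℂ).holderL (torusMeasure N) ⊤ 2 2

lemma coeFn_mulL (a : LinftyTorus N) (f : L2Torus N) :
    mulL N a f =ᵐ[torusMeasure N] fun y => (a y : ℂ) * f y := by
  filter_upwards [ContinuousLinearMap.coeFn_holder (r := 2)
    (ContinuousLinearMap.lsmul ℝ ℝ : ℝ →L[ℝ] ℂ →L[ℝ] ℂ) a f] with y hy
  exact hy.trans (by simp)

/-- `fn` as a continuous linear map. -/
def fnL (N : ℕ) : H1 N →L[ℝ] L2Torus N where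
  toFun := fn
  map_add' _ _ := rfl
  map_smul' _ _ := rfl
  cont := continuous_fst.comp continuous_subtype_val

/-- `weakPartial` as a continuous linear map. -/
def weakPartialL (j : Fin N) : H1 N →L[ℝ] L2Torus N where
  toFun u := weakPartial u j
  map_add' _ _ := rfl
  map_smul' _ _ := rfl
  cont := (continuous_apply j).comp (continuous_snd.comp continuous_subtype_val)

/-- `shiftedGrad` as a continuous linear map. -/
def shiftedGradL (θ : Space N) (j : Fin N) : H1 N →L[ℝ] L2Torus N :=
  weakPartialL j + (2 * Complex.I * Real.pi * (θ j : ℂ)) • fnL N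

lemma shiftedGradL_apply (θ : Space N) (j : Fin N) (u : H1 N) :
    shiftedGradL θ j u = weakPartialL j u + (2 * Complex.I * Real.pi * (θ j : ℂ)) • fnL N u := rfl

lemma coeFn_shiftedGradL (θ : Space N) (j : Fin N) (u : H1 N) :
    shiftedGradL θ j u =ᵐ[torusMeasure N] shiftedGrad θ u j := by
  rw [shiftedGradL_apply]
  filter_upwards [Lp.coeFn_add (weakPartialL j u) ((2 * Complex.I * Real.pi * (θ j : ℂ)) • fnL N u),
    Lp.coeFn_smul (2 * Complex.I * Real.pi * (θ j : ℂ)) (fnL N u)] with y h1 h2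
  rw [h1, Pi.add_apply, h2]
  rfl

lemma inner_mulL (a : LinftyTorus N) (f g : L2Torus N) :
    inner ℂ f (mulL N a g) = ∫ y, (a y : ℂ) * g y * star (f y) ∂(torusMeasure N) := by
  rw [L2.inner_def]
  refine integral_congr_ae ((coeFn_mulL a g).mono fun y hy => ?_)
  simp only [hy, RCLike.inner_apply]
  rfl

lemma integrable_mulL (a : LinftyTorus N) (f g : L2Torus N) :
    Integrable (fun y => (a y : ℂ) * g y * star (f y)) (torusMeasure N) := by
  refine (L2.integrable_inner (𝕜 := ℂ) f (mulL N a g)).congr ((coeFn_mulL a g).mono fun y hy => ?_)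
  simp only [hy, RCLike.inner_apply]
  rfl

lemma inner_mulL_comm (a : LinftyTorus N) (f g : L2Torus N) :
    inner ℂ (mulL N a f) g = inner ℂ f (mulL N a g) := by
  rw [← inner_conj_symm, inner_mulL, inner_mulL, ← integral_conj]
  refine integral_congr_ae (Eventually.of_forall fun y => ?_)
  simp only [map_mul, Complex.conj_ofReal]
  rw [mul_assoc, mul_assoc, mul_comm ((starRingEnd ℂ) (f y)), Complex.star_def, Complex.conj_conj]

section CellForm

variable (A : MatrixCoeff N) (c : ScalarCoeff N)

/-- Expressing the form through inner products and the bounded bilinear map `mulL` lets its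
derivatives be computed in Banach spaces, with no differentiation under the integral. -/
lemma cellForm_eq (x θ : Space N) (u w : H1 N) :
    cellForm A c x θ u w =
      (∑ i, ∑ j, inner ℂ (shiftedGradL θ i w) (mulL N (A i j x) (shiftedGradL θ j u)))
        + inner ℂ (fnL N w) (mulL N (c x) (fnL N u)) := by
  have i1 : ∀ i j, Integrable (fun y => (A i j x y : ℂ) * shiftedGradL θ j u y *
      star (shiftedGradL θ i w y)) (torusMeasure N) := fun i j => integrable_mulL _ _ _
  have i2 := integrable_mulL (c x) (fnL N w) (fnL N u)
  have s1 := integrable_finsetSum Finset.univ fun i _ =>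
    integrable_finsetSum Finset.univ fun j _ => i1 i j
  simp only [inner_mulL]
  simp only [← integral_finsetSum _ fun j _ => i1 _ j]
  rw [← integral_finsetSum _ fun i _ => integrable_finsetSum Finset.univ fun j _ => i1 i j,
    ← integral_add s1 i2]
  refine integral_congr_ae ?_
  filter_upwards [ae_all_iff.2 fun j => coeFn_shiftedGradL θ j u,
    ae_all_iff.2 fun j => coeFn_shiftedGradL θ j w] with y h1 h2
  simp only [h1, h2]
  rfl

variable {A}

lemma cellForm_conj_symm (hA : IsSymmetricCoeff A) (x θ : Space N) (u w : H1 N) :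
    cellForm A c x θ w u = star (cellForm A c x θ u w) := by
  have h : ∀ (a : LinftyTorus N) (f g : L2Torus N),
      (starRingEnd ℂ) (inner ℂ f (mulL N a g)) = inner ℂ g (mulL N a f) := fun a f g => by
    rw [inner_conj_symm, inner_mulL_comm]
  change _ = (starRingEnd ℂ) _
  rw [cellForm_eq, cellForm_eq, map_add, map_sum, h]
  simp only [map_sum, h]
  rw [Finset.sum_comm]
  congr 1
  exact Finset.sum_congr rfl fun i _ => Finset.sum_congr rfl fun j _ => by rw [hA x]

variable (A)

/-- The quadratic form of the cell operator. -/
def cellQuad (P : (Space N × Space N) × H1 N) : ℝ := (cellForm A c P.1.1 P.1.2 P.2 P.2).re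

variable {A c}

/-- The dependence on `θ` and `u` is polynomial, so the regularity in `x` of the coefficients is the
only restriction. -/
lemma contDiffAt_cellQuad {p : Space N × Space N} {u : H1 N}
    (hA : ∀ i j, ContDiffAt ℝ 2 (fun x => A i j x) p.1) (hc : ContDiffAt ℝ 2 (fun x => c x) p.1) :
    ContDiffAt ℝ 2 (cellQuad A c) (p, u) := by
  have hx : ContDiffAt ℝ 2 (fun P : (Space N × Space N) × H1 N => P.1.1) (p, u) :=
    contDiffAt_fst.comp (p, u) contDiffAt_fst
  have hu : ContDiffAt ℝ 2 (fun P : (Space N × Space N) × H1 N => fnL N P.2) (p, u) :=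
    (fnL N).contDiff.contDiffAt.comp (p, u) contDiffAt_snd
  have hS : ∀ j, ContDiffAt ℝ 2
      (fun P : (Space N × Space N) × H1 N => shiftedGradL P.1.2 j P.2) (p, u) := fun j => by
    have h1 : ContDiffAt ℝ 2 (fun P : (Space N × Space N) × H1 N => weakPartialL j P.2) (p, u) :=
      (weakPartialL j).contDiff.contDiffAt.comp (p, u) contDiffAt_snd
    have h0 : ContDiff ℝ 2 (fun z : Space N => (z j : ℂ)) :=
      (Complex.ofRealCLM.comp (EuclideanSpace.proj j : Space N →L[ℝ] ℝ)).contDiff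
    have h2 : ContDiffAt ℝ 2 (fun P : (Space N × Space N) × H1 N => (P.1.2 j : ℂ)) (p, u) :=
      h0.contDiffAt.comp (p, u) (contDiffAt_snd.comp (p, u) contDiffAt_fst)
    exact h1.add ((contDiffAt_const.mul h2).smul hu)
  have hM : ∀ {a : Space N → LinftyTorus N} {f : (Space N × Space N) × H1 N → L2Torus N},
      ContDiffAt ℝ 2 a p.1 → ContDiffAt ℝ 2 f (p, u) →
      ContDiffAt ℝ 2 (fun P => mulL N (a P.1.1) (f P)) (p, u) := fun {a f} ha hf => by
    have h1 : ContDiffAt ℝ 2 (fun P : (Space N × Space N) × H1 N => a P.1.1) (p, u) :=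
      ContDiffAt.comp (p, u) ha hx
    exact ((mulL N).contDiff.contDiffAt.comp (p, u) h1).clm_apply hf
  have key : ContDiffAt ℝ 2 (fun P : (Space N × Space N) × H1 N =>
      (∑ i, ∑ j, inner ℂ (shiftedGradL P.1.2 i P.2)
        (mulL N (A i j P.1.1) (shiftedGradL P.1.2 j P.2)))
        + inner ℂ (fnL N P.2) (mulL N (c P.1.1) (fnL N P.2))) (p, u) := by
    refine ContDiffAt.add (ContDiffAt.sum fun i _ => ContDiffAt.sum fun j _ => ?_) ?_
    · exact (hS i).inner ℂ (hM (hA i j) (hS j))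
    · exact hu.inner ℂ (hM hc hu)
  have h2 : cellQuad A c = fun P => Complex.reCLM ((∑ i, ∑ j, inner ℂ (shiftedGradL P.1.2 i P.2)
        (mulL N (A i j P.1.1) (shiftedGradL P.1.2 j P.2)))
        + inner ℂ (fnL N P.2) (mulL N (c P.1.1) (fnL N P.2))) :=
    funext fun P => by
      rw [← cellForm_eq]
      rfl
  rw [h2]
  exact Complex.reCLM.contDiff.contDiffAt.comp (p, u) key

lemma hasDerivAt_mulL (a : LinftyTorus N) {f : ℝ → L2Torus N} {f' : L2Torus N} {t : ℝ}
    (hf : HasDerivAt f f' t) : HasDerivAt (fun t => mulL N a (f t)) (mulL N a f') t :=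
  (mulL N a).hasFDerivAt.comp_hasDerivAt t hf

/-- The derivative of the quadratic form of the cell operator in the direction of `w`. -/
lemma fderiv_cellQuad_snd (hAs : IsSymmetricCoeff A) {p : Space N × Space N} {u : H1 N}
    (hq : DifferentiableAt ℝ (cellQuad A c) (p, u)) (w : H1 N) :
    fderiv ℝ (cellQuad A c) (p, u) (0, w) = 2 * (cellForm A c p.1 p.2 u w).re := by
  have hline : HasDerivAt (fun t : ℝ => ((p, u + t • w) : (Space N × Space N) × H1 N)) (0, w) 0 := by
    have h1 : HasDerivAt (fun t : ℝ => u + t • w) w 0 := by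
      simpa using ((hasDerivAt_id (0 : ℝ)).smul_const w).const_add u
    exact (hasDerivAt_const _ p).prodMk h1
  have hq' : HasFDerivAt (cellQuad A c) (fderiv ℝ (cellQuad A c) (p, u)) (p, u + (0 : ℝ) • w) := by
    simpa using hq.hasFDerivAt
  have h1 := hq'.comp_hasDerivAt (0 : ℝ) hline
  have hlin : ∀ L : H1 N →L[ℝ] L2Torus N, HasDerivAt (fun t : ℝ => L (u + t • w)) (L w) 0 :=
    fun L => L.hasFDerivAt.comp_hasDerivAt (0 : ℝ) (by
      simpa using ((hasDerivAt_id (0 : ℝ)).smul_const w).const_add u)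
  have h2 : HasDerivAt (fun t : ℝ => cellForm A c p.1 p.2 (u + t • w) (u + t • w))
      (cellForm A c p.1 p.2 w u + cellForm A c p.1 p.2 u w) 0 := by
    simp only [cellForm_eq]
    have e1 := fun i j => (hlin (shiftedGradL p.2 i)).inner ℂ
      (hasDerivAt_mulL (A i j p.1) (hlin (shiftedGradL p.2 j)))
    have e2 := (hlin (fnL N)).inner ℂ (hasDerivAt_mulL (c p.1) (hlin (fnL N)))
    have e3 := (HasDerivAt.fun_sum (u := Finset.univ) fun i _ =>
      HasDerivAt.fun_sum (u := Finset.univ) fun j _ => e1 i j).add e2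
    refine e3.congr_deriv ?_
    simp only [zero_smul, add_zero, Finset.sum_add_distrib]
    ring
  have h3 : HasDerivAt (fun t : ℝ => cellQuad A c (p, u + t • w))
      (cellForm A c p.1 p.2 w u + cellForm A c p.1 p.2 u w).re 0 :=
    Complex.reCLM.hasFDerivAt.comp_hasDerivAt (0 : ℝ) h2
  rw [h1.unique h3, cellForm_conj_symm c hAs, Complex.add_re, Complex.star_def, Complex.conj_re]
  ring

/-- The flux term `∑_j ∫ A_{kj} ((∇_y + 2iπθ) u)_j conj(u)`. -/
def flux (A : MatrixCoeff N) (k : Fin N) (P : (Space N × Space N) × H1 N) : ℂ :=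
  ∑ j, inner ℂ (fnL N P.2) (mulL N (A k j P.1.1) (shiftedGradL P.1.2 j P.2))

/-- The derivative of the quadratic form of the cell operator in `θ_k`. -/
lemma fderiv_cellQuad_dθ (hAs : IsSymmetricCoeff A) {p : Space N × Space N} {u : H1 N}
    (hq : DifferentiableAt ℝ (cellQuad A c) (p, u)) (k : Fin N) :
    fderiv ℝ (cellQuad A c) (p, u) (dθ k, 0) = 4 * Real.pi * (flux A k (p, u)).im := by
  set κ : ℂ := 2 * Complex.I * Real.pi with hκ
  have hline : HasDerivAt (fun t : ℝ => ((p + t • dθ k, u) : (Space N × Space N) × H1 N))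
      (dθ k, 0) 0 := by
    have h1 : HasDerivAt (fun t : ℝ => p + t • (dθ k : Space N × Space N)) (dθ k) 0 := by
      simpa using ((hasDerivAt_id (0 : ℝ)).smul_const (dθ k : Space N × Space N)).const_add p
    exact h1.prodMk (hasDerivAt_const _ u)
  have hq' : HasFDerivAt (cellQuad A c) (fderiv ℝ (cellQuad A c) (p, u))
      (p + (0 : ℝ) • dθ k, u) := by
    simpa using hq.hasFDerivAt
  have h1 := hq'.comp_hasDerivAt (0 : ℝ) hline
  have hS : ∀ j, HasDerivAt (fun t : ℝ => shiftedGradL (p + t • dθ k).2 j u)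
      ((if j = k then κ else 0) • fnL N u) 0 := fun j => by
    have e1 : ∀ t : ℝ, shiftedGradL (p + t • dθ k).2 j u =
        shiftedGradL p.2 j u + (t : ℂ) • ((if j = k then κ else 0) • fnL N u) := fun t => by
      have : (p + t • dθ k).2 j = p.2 j + t * (if j = k then 1 else 0) := by
        simp [dθ, e]
      rw [shiftedGradL_apply, shiftedGradL_apply, this, smul_smul, add_assoc, ← add_smul]
      congr 2
      split_ifs <;> push_cast <;> ring
    simp only [e1]
    simpa using ((hasDerivAt_id (0 : ℝ)).ofReal_comp.smul_const
      ((if j = k then κ else 0) • fnL N u)).const_add (shiftedGradL p.2 j u)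
  have h2 : HasDerivAt (fun t : ℝ => cellForm A c (p + t • dθ k).1 (p + t • dθ k).2 u u)
      (κ * star (flux A k (p, u)) + star κ * flux A k (p, u)) 0 := by
    have hx : ∀ t : ℝ, (p + t • dθ k).1 = p.1 := fun t => by simp [dθ]
    simp only [cellForm_eq, hx]
    have e1 := fun i j => (hS i).inner ℂ (hasDerivAt_mulL (A i j p.1) (hS j))
    have e3 := (HasDerivAt.fun_sum (u := Finset.univ) fun i _ =>
      HasDerivAt.fun_sum (u := Finset.univ) fun j _ => e1 i j).add_const
        (inner ℂ (fnL N u) (mulL N (c p.1) (fnL N u)))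
    refine e3.congr_deriv ?_
    -- `mulL` is only real bilinear by construction, so complex homogeneity is checked pointwise.
    have hcomm : ∀ (a : LinftyTorus N) (r : ℂ) (f : L2Torus N),
        mulL N a (r • f) = r • mulL N a f := fun a r f => by
      refine Lp.ext ?_
      filter_upwards [coeFn_mulL a (r • f), coeFn_mulL a f, Lp.coeFn_smul r f,
        Lp.coeFn_smul r (mulL N a f)] with y h1 h2 h3 h4
      rw [h1, h4, Pi.smul_apply, h2, h3, Pi.smul_apply, smul_eq_mul, smul_eq_mul]
      ring
    simp only [zero_smul, add_zero, Finset.sum_add_distrib, hcomm, inner_smul_left,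
      inner_smul_right, ite_mul, zero_mul, Finset.sum_ite_eq', Finset.mem_univ, if_true,
      apply_ite (starRingEnd ℂ), map_zero]
    rw [Finset.sum_comm (f := fun i j => if i = k then _ else _)]
    simp only [Finset.sum_ite_eq', Finset.mem_univ, if_true, ← Finset.mul_sum, flux]
    congr 2
    change _ = (starRingEnd ℂ) _
    rw [map_sum]
    refine Finset.sum_congr rfl fun i _ => ?_
    rw [inner_conj_symm, inner_mulL_comm, hAs]
  have h3 : HasDerivAt (fun t : ℝ => cellQuad A c (p + t • dθ k, u))
      (κ * star (flux A k (p, u)) + star κ * flux A k (p, u)).re 0 :=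
    Complex.reCLM.hasFDerivAt.comp_hasDerivAt (0 : ℝ) h2
  -- With `κ = 2iπ`, the sum `κ star F + star κ F` equals `4π Im F`.
  rw [h1.unique h3]
  simp [hκ]
  ring

end CellForm

/-! ### The Hessian of the Bloch eigenvalue -/

section Branch

variable {A : MatrixCoeff N} {c : ScalarCoeff N} {n : ℕ} {x₀ θ₀ : Space N}
  {ψ : Space N × Space N → H1 N}

/-- Varying the eigenfunction changes the form by `2 λ_n Re ⟨∂ψ, ψ⟩`, which vanishes by
normalization. Only the explicit dependence on `(x, θ)` contributes. -/
lemma IsBlochBranch.hellmannFeynman (hψ : IsBlochBranch A c n x₀ θ₀ ψ) (hAs : IsSymmetricCoeff A)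
    (hA : ∀ i j, ContDiffAt ℝ 2 (fun x => A i j x) x₀) (hc : ContDiffAt ℝ 2 (fun x => c x) x₀) :
    ContDiffAt ℝ 2 (blochFun A c n) (x₀, θ₀) ∧ ∀ᶠ p in 𝓝 (x₀, θ₀), ∀ k,
      fderiv ℝ (blochFun A c n) p (dθ k) = 4 * Real.pi * (flux A k (p, ψ p)).im := by
  have hq : ContDiffAt ℝ 2 (cellQuad A c) ((x₀, θ₀), ψ (x₀, θ₀)) := contDiffAt_cellQuad hA hc
  have hq' : ∀ᶠ p in 𝓝 (x₀, θ₀), DifferentiableAt ℝ (cellQuad A c) (p, ψ p) :=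
    (continuousAt_id.prodMk hψ.1.continuousAt).eventually
      ((hq.eventually (by simp)).mono fun P hP => hP.differentiableAt (by simp))
  have hψ' : ∀ᶠ p in 𝓝 (x₀, θ₀), DifferentiableAt ℝ ψ p :=
    (hψ.1.eventually (by simp)).mono fun p hp => hp.differentiableAt (by simp)
  have hl : ∀ᶠ p in 𝓝 (x₀, θ₀), blochFun A c n p = cellQuad A c (p, ψ p) := by
    filter_upwards [hψ.2] with p hp
    rw [cellQuad, hp.1 (ψ p), inner_self_eq_norm_sq_to_K, hp.2]
    simp [blochFun]
  have hcrit : ∀ᶠ p in 𝓝 (x₀, θ₀), ∀ v,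
      fderiv ℝ (cellQuad A c) (p, ψ p) (0, fderiv ℝ ψ p v) = 0 := by
    filter_upwards [hq', hψ', hψ.2.eventually_nhds] with p h1 h2 h3 v
    have hline : HasDerivAt (fun t : ℝ => p + t • v) v 0 := by
      simpa using ((hasDerivAt_id (0 : ℝ)).smul_const v).const_add p
    have h2' : HasFDerivAt ψ (fderiv ℝ ψ p) (p + (0 : ℝ) • v) := by simpa using h2.hasFDerivAt
    have hd := (fnL N).hasFDerivAt.comp_hasDerivAt (0 : ℝ) (h2'.comp_hasDerivAt (0 : ℝ) hline)
    have hn := hd.inner ℂ hd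
    -- The norm is constant along the branch, so `∂ψ` is orthogonal to `ψ` in the real sense.
    have hone : (fun t : ℝ => inner ℂ (fnL N (ψ (p + t • v))) (fnL N (ψ (p + t • v)))) =ᶠ[𝓝 0]
        fun _ => (1 : ℂ) := by
      have ht : Tendsto (fun t : ℝ => p + t • v) (𝓝 0) (𝓝 p) := by
        simpa using hline.continuousAt.tendsto
      filter_upwards [ht.eventually h3] with t ht
      have : ‖fnL N (ψ (p + t • v))‖ = 1 := ht.2
      rw [inner_self_eq_norm_sq_to_K, this]
      simp
    have h0 := hn.unique ((hasDerivAt_const (0 : ℝ) (1 : ℂ)).congr_of_eventuallyEq hone)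
    simp only [Function.comp_apply, zero_smul, add_zero] at h0
    rw [← inner_conj_symm (fnL N (ψ p)), add_comm, Complex.add_conj] at h0
    have h0' : (inner ℂ (fnL N (fderiv ℝ ψ p v)) (fnL N (ψ p))).re = 0 := by
      simpa using h0
    rw [fderiv_cellQuad_snd hAs h1, h3.self_of_nhds.1, Complex.re_ofReal_mul]
    change 2 * (_ * (inner ℂ (fnL N (fderiv ℝ ψ p v)) (fnL N (ψ p))).re) = 0
    rw [h0']
    ring
  obtain ⟨g1, g2⟩ := contDiffAt_two_of_critical hq hψ.1 hl hcrit
  refine ⟨g1, ?_⟩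
  filter_upwards [g2, hq'] with p h1 h2 k
  rw [h1, fderiv_cellQuad_dθ hAs h2]

/-- The derivative in `x_k` of the flux term along the branch. -/
def fluxDeriv (A : MatrixCoeff N) (x₀ θ₀ : Space N) (ψ : Space N × Space N → H1 N) (k : Fin N) :
    ℂ :=
  ∑ j, (inner ℂ (fnL N (ψ (x₀, θ₀)))
      (mulL N (A k j x₀) (shiftedGradL θ₀ j (branchDeriv ψ x₀ θ₀ k))
        + mulL N (coeffDeriv A x₀ k k j) (shiftedGradL θ₀ j (ψ (x₀, θ₀))))
    + inner ℂ (fnL N (branchDeriv ψ x₀ θ₀ k))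
      (mulL N (A k j x₀) (shiftedGradL θ₀ j (ψ (x₀, θ₀)))))

lemma hasDerivAt_flux (hψ : DifferentiableAt ℝ ψ (x₀, θ₀))
    (hA : ∀ i j, DifferentiableAt ℝ (fun x => A i j x) x₀) (k : Fin N) :
    HasDerivAt (fun t : ℝ => flux A k ((x₀, θ₀) + t • dx k, ψ ((x₀, θ₀) + t • dx k)))
      (fluxDeriv A x₀ θ₀ ψ k) 0 := by
  have hp : ∀ t : ℝ, (x₀, θ₀) + t • dx k = (x₀ + t • e k, θ₀) := fun t => by simp [dx]
  have hline : HasDerivAt (fun t : ℝ => (x₀, θ₀) + t • (dx k : Space N × Space N)) (dx k) 0 := by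
    simpa using ((hasDerivAt_id (0 : ℝ)).smul_const (dx k : Space N × Space N)).const_add (x₀, θ₀)
  have hxline : HasDerivAt (fun t : ℝ => x₀ + t • (e k : Space N)) (e k) 0 := by
    simpa using ((hasDerivAt_id (0 : ℝ)).smul_const (e k : Space N)).const_add x₀
  have h2 : HasFDerivAt ψ (fderiv ℝ ψ (x₀, θ₀)) ((x₀, θ₀) + (0 : ℝ) • dx k) := by
    simpa using hψ.hasFDerivAt
  have hd : ∀ L : H1 N →L[ℝ] L2Torus N, HasDerivAt
      (fun t : ℝ => L (ψ ((x₀, θ₀) + t • dx k))) (L (branchDeriv ψ x₀ θ₀ k)) 0 := fun L =>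
    L.hasFDerivAt.comp_hasDerivAt (0 : ℝ) (h2.comp_hasDerivAt (0 : ℝ) hline)
  have ha : ∀ j, HasDerivAt (fun t : ℝ => mulL N (A k j (x₀ + t • e k)))
      (mulL N (coeffDeriv A x₀ k k j)) 0 := fun j => by
    have h3 : HasFDerivAt (fun x => A k j x) (fderiv ℝ (fun x => A k j x) x₀)
        (x₀ + (0 : ℝ) • e k) := by simpa using (hA k j).hasFDerivAt
    exact (mulL N).hasFDerivAt.comp_hasDerivAt (0 : ℝ) (h3.comp_hasDerivAt (0 : ℝ) hxline)
  have key : HasDerivAt (fun t : ℝ => ∑ j, inner ℂ (fnL N (ψ ((x₀, θ₀) + t • dx k)))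
      (mulL N (A k j (x₀ + t • e k)) (shiftedGradL θ₀ j (ψ ((x₀, θ₀) + t • dx k)))))
      (fluxDeriv A x₀ θ₀ ψ k) 0 := by
    refine (HasDerivAt.fun_sum fun j _ => (hd (fnL N)).inner ℂ
      ((ha j).clm_apply (hd (shiftedGradL θ₀ j)))).congr_deriv ?_
    simp only [zero_smul, add_zero, fluxDeriv]
    refine Finset.sum_congr rfl fun j _ => ?_
    rw [add_comm (mulL N (coeffDeriv A x₀ k k j) _)]
  refine key.congr_of_eventuallyEq (Eventually.of_forall fun t => ?_)
  simp only [flux, hp]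

/-- The derivative along `w` is known on the line of direction `v`, which yields the second
derivative in the order `v, w`; Schwarz symmetry exchanges them. -/
lemma fderiv_fderiv_eq_of_hasDerivAt {E : Type*} [NormedAddCommGroup E] [NormedSpace ℝ E]
    {f : E → ℝ} {p v w : E} (hf : ContDiffAt ℝ 2 f p) {g : ℝ → ℝ} {g' : ℝ} (hg : HasDerivAt g g' 0)
    (h : ∀ᶠ q in 𝓝 p, ∀ t : ℝ, q = p + t • v → fderiv ℝ f q w = g t) :
    fderiv ℝ (fderiv ℝ f) p w v = g' := by
  have hsymm : IsSymmSndFDerivAt ℝ f p := hf.isSymmSndFDerivAt (by simp)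
  have hd : DifferentiableAt ℝ (fderiv ℝ f) p :=
    (hf.fderiv_right (m := 1) (by norm_num)).differentiableAt (by simp)
  have hline : HasDerivAt (fun t : ℝ => p + t • v) v 0 := by
    simpa using ((hasDerivAt_id (0 : ℝ)).smul_const v).const_add p
  have hp : p + (0 : ℝ) • v = p := by simp
  have hd' : HasFDerivAt (fderiv ℝ f) (fderiv ℝ (fderiv ℝ f) p) (p + (0 : ℝ) • v) := by
    rw [hp]
    exact hd.hasFDerivAt
  have hw : HasFDerivAt (fun q => fderiv ℝ f q w)
      ((ContinuousLinearMap.apply ℝ ℝ w).comp (fderiv ℝ (fderiv ℝ f) p)) (p + (0 : ℝ) • v) :=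
    (ContinuousLinearMap.apply ℝ ℝ w).hasFDerivAt.comp _ hd'
  have g0 := HasFDerivAt.comp_hasDerivAt (0 : ℝ) hw hline
  have g1 : HasDerivAt (fun t : ℝ => fderiv ℝ f (p + t • v) w)
      (fderiv ℝ (fderiv ℝ f) p v w) 0 := g0
  have ht : Tendsto (fun t : ℝ => p + t • v) (𝓝 0) (𝓝 p) := by
    simpa using hline.continuousAt.tendsto
  have g4 : HasDerivAt (fun t : ℝ => fderiv ℝ f (p + t • v) w) g' 0 :=
    hg.congr_of_eventuallyEq ((ht.eventually h).mono fun t ht => ht t rfl)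
  rw [hsymm w v, g1.unique g4]

lemma IsBlochBranch.secondDeriv_eq (hψ : IsBlochBranch A c n x₀ θ₀ ψ) (hAs : IsSymmetricCoeff A)
    (hA : ∀ i j, ContDiffAt ℝ 2 (fun x => A i j x) x₀) (hc : ContDiffAt ℝ 2 (fun x => c x) x₀)
    (k : Fin N) :
    secondDeriv (blochFun A c n) (x₀, θ₀) (dθ k) (dx k) =
      4 * Real.pi * (fluxDeriv A x₀ θ₀ ψ k).im := by
  obtain ⟨h1, h2⟩ := hψ.hellmannFeynman hAs hA hc
  have g2 := hasDerivAt_flux (hψ.1.differentiableAt (by simp))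
    (fun i j => (hA i j).differentiableAt (by simp)) k
  have g3 : HasDerivAt (fun t : ℝ => 4 * Real.pi *
      (flux A k ((x₀, θ₀) + t • dx k, ψ ((x₀, θ₀) + t • dx k))).im)
      (4 * Real.pi * (fluxDeriv A x₀ θ₀ ψ k).im) 0 :=
    (Complex.imCLM.hasFDerivAt.comp_hasDerivAt (0 : ℝ) g2).const_mul _
  refine fderiv_fderiv_eq_of_hasDerivAt h1 g3 (h2.mono fun p hp t ht => ?_)
  rw [hp k, ht]

/-- For a real multiplier `a`, exchanging `f` and `g` conjugates `⟨f, a g⟩` and flips its imaginary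
part. The two negative terms of `c*` thereby become the missing positive terms of `fluxDeriv`. -/
lemma homC_im (A : MatrixCoeff N) (x₀ θ₀ : Space N) (ψ : Space N × Space N → H1 N) :
    (homC A x₀ θ₀ ψ).im = ∑ k, (fluxDeriv A x₀ θ₀ ψ k).im := by
  have e1 : ∀ (a : LinftyTorus N) (f g : L2Torus N),
      Integrable (fun y => (a y : ℂ) * star (f y) * g y) (torusMeasure N) ∧
      ∫ y, (a y : ℂ) * star (f y) * g y ∂(torusMeasure N) = inner ℂ f (mulL N a g) := by
    intro a f g
    rw [inner_mulL]
    exact ⟨(integrable_mulL a f g).congr (Eventually.of_forall fun y => by ring_nf),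
      integral_congr_ae (Eventually.of_forall fun y => by ring_nf)⟩
  set u := ψ (x₀, θ₀) with hu
  set S := fun j => shiftedGradL θ₀ j u with hS
  set T := fun k j => shiftedGradL θ₀ j (branchDeriv ψ x₀ θ₀ k) with hT
  have i1 : ∀ k j, Integrable (fun y =>
      (A k j x₀ y : ℂ) * S j y * star (fnL N (branchDeriv ψ x₀ θ₀ k) y)
      - (A k j x₀ y : ℂ) * star (T k j y) * fnL N u y
      - (coeffDeriv A x₀ k k j y : ℂ) * star (S j y) * fnL N u y) (torusMeasure N) := fun k j =>
    ((integrable_mulL _ _ _).sub' (e1 _ _ _).1).sub' (e1 _ _ _).1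
  have h1 : homC A x₀ θ₀ ψ = ∑ k, ∑ j,
      (inner ℂ (fnL N (branchDeriv ψ x₀ θ₀ k)) (mulL N (A k j x₀) (S j))
      - inner ℂ (T k j) (mulL N (A k j x₀) (fnL N u))
      - inner ℂ (S j) (mulL N (coeffDeriv A x₀ k k j) (fnL N u))) := by
    have h2 : ∀ k j, inner ℂ (fnL N (branchDeriv ψ x₀ θ₀ k)) (mulL N (A k j x₀) (S j))
      - inner ℂ (T k j) (mulL N (A k j x₀) (fnL N u))
      - inner ℂ (S j) (mulL N (coeffDeriv A x₀ k k j) (fnL N u)) = ∫ y,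
      ((A k j x₀ y : ℂ) * S j y * star (fnL N (branchDeriv ψ x₀ θ₀ k) y)
      - (A k j x₀ y : ℂ) * star (T k j y) * fnL N u y
      - (coeffDeriv A x₀ k k j y : ℂ) * star (S j y) * fnL N u y) ∂(torusMeasure N) := by
      intro k j
      rw [integral_sub ((integrable_mulL _ _ _).sub' (e1 _ _ _).1) (e1 _ _ _).1,
        integral_sub (integrable_mulL _ _ _) (e1 _ _ _).1, (e1 _ _ _).2, (e1 _ _ _).2, inner_mulL]
    simp only [h2]
    simp only [← integral_finsetSum _ fun j _ => i1 _ j]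
    rw [← integral_finsetSum _ fun k _ => integrable_finsetSum Finset.univ fun j _ => i1 k j, homC]
    refine integral_congr_ae ?_
    filter_upwards [ae_all_iff.2 fun j => coeFn_shiftedGradL θ₀ j u,
      ae_all_iff.2 fun k => ae_all_iff.2 fun j =>
        coeFn_shiftedGradL θ₀ j (branchDeriv ψ x₀ θ₀ k)] with y y1 y2
    simp only [hS, hT, y1, y2]
    rfl
  have him : ∀ (a : LinftyTorus N) (f g : L2Torus N),
      (inner ℂ f (mulL N a g)).im = -(inner ℂ g (mulL N a f)).im := fun a f g => by
    rw [← inner_mulL_comm, ← inner_conj_symm, Complex.conj_im]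
  rw [h1, Complex.im_sum]
  refine Finset.sum_congr rfl fun k _ => ?_
  rw [fluxDeriv, Complex.im_sum, Complex.im_sum]
  refine Finset.sum_congr rfl fun j _ => ?_
  rw [Complex.sub_im, Complex.sub_im, him _ (T k j), him _ (S j), inner_add_right, Complex.add_im,
    Complex.add_im]
  ring

/-! ### Algebraic properties of the homogenized coefficients. -/

lemma IsBlochBranch.trace_homB (hψ : IsBlochBranch A c n x₀ θ₀ ψ) (hAs : IsSymmetricCoeff A)
    (hA : ∀ i j, ContDiffAt ℝ 2 (fun x => A i j x) x₀) (hc : ContDiffAt ℝ 2 (fun x => c x) x₀) :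
    (homB A c n x₀ θ₀).trace = -(2 * Complex.I) * ((homC A x₀ θ₀ ψ).im : ℂ) := by
  have hπ : (Real.pi : ℂ) ≠ 0 := Complex.ofReal_ne_zero.2 Real.pi_ne_zero
  rw [homC_im, Complex.ofReal_sum, Finset.mul_sum, Matrix.trace]
  refine Finset.sum_congr rfl fun k _ => ?_
  simp only [homB, Matrix.diag_apply, Matrix.of_apply]
  -- The prefactor `1/(2iπ)` times `4π` is `-2i`.
  rw [hψ.secondDeriv_eq hAs hA hc k]
  push_cast
  field_simp
  rw [Complex.I_sq]
  ring

lemma homB_star (A : MatrixCoeff N) (c : ScalarCoeff N) (n : ℕ) (x₀ θ₀ : Space N) (i j : Fin N) :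
    star (homB A c n x₀ θ₀ i j) = -homB A c n x₀ θ₀ i j := by
  simp only [homB, Matrix.of_apply, Complex.star_def, map_mul, map_div₀, map_one, Complex.conj_I,
    Complex.conj_ofReal, map_ofNat]
  ring

lemma IsBlochBranch.homA_isSymm (hψ : IsBlochBranch A c n x₀ θ₀ ψ) (hAs : IsSymmetricCoeff A)
    (hA : ∀ i j, ContDiffAt ℝ 2 (fun x => A i j x) x₀) (hc : ContDiffAt ℝ 2 (fun x => c x) x₀) :
    (homA A c n x₀ θ₀).IsSymm := by
  have hsymm := (hψ.hellmannFeynman hAs hA hc).1.isSymmSndFDerivAt (by simp)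
  refine Matrix.IsSymm.ext fun i j => ?_
  simp only [homA, Matrix.of_apply, secondDeriv]
  rw [hsymm]

end Branch

end BlochHom

end

/-! ### Conclusion. -/

theorem proposition3p4 {N : ℕ} (A : BlochHom.MatrixCoeff N) (c : BlochHom.ScalarCoeff N)
    (hAsymm : BlochHom.IsSymmetricCoeff A) (hAcoer : BlochHom.IsUniformlyCoercive A)
    (n : ℕ) (hn : 1 ≤ n) (x₀ θ₀ : BlochHom.Space N)
    (hsimple : Module.finrank ℂ
      (BlochHom.cellEigenspace A c x₀ θ₀ (BlochHom.blochEigenvalue A c n x₀ θ₀)) = 1)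
    (hcrit : HasFDerivAt (BlochHom.blochFun A c n)
      (0 : BlochHom.Space N × BlochHom.Space N →L[ℝ] ℝ) (x₀, θ₀))
    (hA : ∀ i j, ContDiffAt ℝ 2 (fun x => A i j x) x₀)
    (hc : ContDiffAt ℝ 2 (fun x => c x) x₀)
    (ψ : BlochHom.Space N × BlochHom.Space N → BlochHom.H1 N)
    (hψ : BlochHom.IsBlochBranch A c n x₀ θ₀ ψ) :
    (∀ (v₀ : BlochHom.L2Space N) (v : ℝ → BlochHom.L2Space N),
      BlochHom.SolvesHom (BlochHom.homA A c n x₀ θ₀) (BlochHom.homB A c n x₀ θ₀)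
        (BlochHom.homC A x₀ θ₀ ψ) (BlochHom.homD A c n x₀ θ₀) v₀ v →
      ∀ t : ℝ, 0 ≤ t → ‖v t‖ = ‖v₀‖) ∧
    IsSelfAdjoint (BlochHom.homOperator (BlochHom.homA A c n x₀ θ₀)
      (BlochHom.homB A c n x₀ θ₀) (BlochHom.homC A x₀ θ₀ ψ) (BlochHom.homD A c n x₀ θ₀)) ∧
    1 / (2 * Complex.I) * (BlochHom.homB A c n x₀ θ₀).trace
      + ((BlochHom.homC A x₀ θ₀ ψ).im : ℂ) = 0 := by
  have ha := hψ.homA_isSymm hAsymm hA hc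
  have hb := BlochHom.homB_star A c n x₀ θ₀
  have htr := hψ.trace_homB hAsymm hA hc
  -- Since `star c* = c* - 2i Im c*`, the trace identity is exactly the condition for formal
  -- symmetry.
  have hstar : star (BlochHom.homC A x₀ θ₀ ψ) =
      BlochHom.homC A x₀ θ₀ ψ + (BlochHom.homB A c n x₀ θ₀).trace := by
    rw [htr]
    apply Complex.ext <;> simp
    ring
  refine ⟨fun v₀ v hv t ht => hv.norm_eq ha hb hstar ht,
    BlochHom.isSelfAdjoint_homOperator ha hb hstar, ?_⟩
  rw [htr]
  field_simp
  ring
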